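/- Fix a set $\mathcal G$ of one- and two-qubit gates that contains the Hadamard gate and CNOT (for example a standard universal gate set, or all one- and two-qubit gates), a constant $0<c<1$, and $m=m(n)$ with $m=\omega(\log n)$. All families are indexed by $n$. An *efficient quantum algorithm* is a deterministic polynomial-time program that, on the public parameters $1^n,1^{m(n)},1^{\kappa(n)}$, writes a quantum circuit over $\mathcal G$. An *$(n+m)$-qubit PRS with key length $\kappa$* is a family of pure states $\{|\psi_k\rangle\}_{k\in\{0,1\}^{\kappa(n)}}$ on $n+m(n)$ qubits such that an efficient quantum algorithm prepares $|\psi_k\rangle$ from $k$, and such that for every polynomial $t$ and every efficient quantum algorithm $\mathcal A$ $$\Big|\Pr_{k}[\mathcal A(|\psi_k\rangle^{\otimes t(n)})=1]-\Pr_{\varphi\sim\mathrm{Haar}}[\mathcal A(|\varphi\rangle^{\otimes t(n)})=1]\Big|=\mathrm{negl}(n).$$ From such a PRS form the ensemble $\rho_k=\mathrm{tr}_m|\psi_k\rangle\langle\psi_k|$ of $n$-qubit density matrices (tracing out the last $m$ qubits), and let $\nu_0=2^{-\kappa}\sum_k\rho_k$ and $\nu_1=I/2^n$. Two families $(\nu_0,\nu_1)$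 of $n$-qubit states form an *EFI pair* with security parameter $\kappa=\kappa(n)$ if (i) each $\nu_b$ is prepared by an efficient quantum algorithm, (ii) $\|\nu_0-\nu_1\|_1=\Omega(1/\mathrm{poly}(\kappa))$, and (iii) $|\Pr[\mathcal A(\nu_0)=1]-\Pr[\mathcal A(\nu_1)=1]|=\mathrm{negl}(\kappa)$ for every efficient quantum algorithm $\mathcal A$. **Theorem.** 1. If $\kappa=\lfloor c(n+m)\rfloor$ and $m<\frac n2(1-c)-\frac12$ for all large $n$, then $(\nu_0,\nu_1)$ is an EFI pair. 2. For each $n$ let $\Phi(\rho)=\sum_{i=1}^{r}p_iU_i\rho U_i^\dagger$ be a mixed unitary channel on $n$ qubits (with $r$, $p_i$, $U_i$ depending on $n$) such that the family is carried out by an efficient quantum algorithm, and let $H(\{p_i\}_i)=-\sum_i p_i\log_2p_i$. If $\kappa=\lfloor cn\rfloor$ and $H(\{p_i\}_i)\le n(1-c)-m-2$ for all large $n$, then $(\Phi(\nu_0),\Phi(\nu_1))$ is an EFI pair. 3. With $\Phi$ as in 2, if $\kappa=\lfloor c(n+m)\rfloor$ and $H(\{p_i\}_i)\le n(1-c)-(1+c)m-2$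 for all large $n$, then $(\Phi(\nu_0),\Phi(\nu_1))$ is an EFI pair. -/

import Mathlib

open Filter MeasureTheory

namespace QCrypto

noncomputable section

/-! ## Qubit registers and operators on them -/

/-- Operators on a register of qubits labelled by `ι`, in the computational basis. -/
abbrev Op (ι : Type) := Matrix (ι → Bool) (ι → Bool) ℂ

/-- The projector `|ψ⟩⟨ψ|`. -/
def pureState {ι : Type} (ψ : (ι → Bool) → ℂ) : Op ι :=
  Matrix.of fun x y => ψ x * star (ψ y)

/-- The projector `|k⟩⟨k|` on a computational basis vector. -/
def basisState {ι : Type} [DecidableEq ι] [Fintype ι] (k : ι → Bool) : Op ι :=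
  Matrix.single k k 1

/-- The maximally mixed state `I / 2^n`. -/
def maxMixed (n : ℕ) : Op (Fin n) := ((2 : ℂ) ^ n)⁻¹ • (1 : Op (Fin n))

/-- The state `ρ^{⊗ t}`; qubit `j` of copy `i` has the label `(i, j)`. -/
def copies {N : ℕ} (t : ℕ) (ρ : Op (Fin N)) : Op (Fin t × Fin N) :=
  Matrix.of fun x y => ∏ i, ρ (fun j => x (i, j)) (fun j => y (i, j))

/-- The partial trace over the last `m` of `n + m` qubits. -/
def traceLast {n m : ℕ} (ρ : Op (Fin (n + m))) : Op (Fin n) :=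
  Matrix.of fun a b => ∑ c : Fin m → Bool, ρ (Fin.append a c) (Fin.append b c)

/-- The trace norm `‖A‖₁`, the sum of the singular values of `A`. -/
def traceNorm {ι : Type} [Fintype ι] [DecidableEq ι] (A : Matrix ι ι ℂ) : ℝ :=
  ∑ i, Real.sqrt ((Matrix.isHermitian_conjTranspose_mul_self A).eigenvalues i)

/-! ## Haar random pure states -/

section Haar

variable (ι : Type) [Fintype ι] [DecidableEq ι]

instance unitaryMeasurableSpace : MeasurableSpace (Matrix.unitaryGroup ι ℂ) := borel _

instance unitaryBorelSpace : BorelSpace (Matrix.unitaryGroup ι ℂ) := ⟨rfl⟩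

instance unitaryCompactSpace : CompactSpace (Matrix.unitaryGroup ι ℂ) := by
  refine isCompact_iff_compactSpace.mp ?_
  have hK : IsCompact (Set.pi Set.univ fun _ : ι => Set.pi Set.univ fun _ : ι =>
      Metric.closedBall (0 : ℂ) 1) :=
    isCompact_univ_pi fun _ => isCompact_univ_pi fun _ => isCompact_closedBall 0 1
  have hc : IsClosed {A : Matrix ι ι ℂ | A ∈ Matrix.unitaryGroup ι ℂ} := by
    have : {A : Matrix ι ι ℂ | A ∈ Matrix.unitaryGroup ι ℂ} = {A | A * star A = 1} := by
      ext A
      exact Matrix.mem_unitaryGroup_iff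
    rw [this]
    exact isClosed_eq (by fun_prop) (by fun_prop)
  refine IsCompact.of_isClosed_subset hK hc ?_
  intro A hA i _ j _
  simpa using entry_norm_bound_of_unitary hA i j

/-- The Haar probability measure on the unitary group. -/
def haarUnitary : Measure (Matrix.unitaryGroup ι ℂ) := Measure.haarMeasure ⊤

/-- The Haar measure on the pure states of `N` qubits: the law of `U |0…0⟩`, with `U` a Haar random
unitary. -/
def haarState (N : ℕ) : Measure ((Fin N → Bool) → ℂ) :=
  (haarUnitary (Fin N → Bool)).map fun U x => U.1 x fun _ => false

instance haarUnitary_isProbabilityMeasure : IsProbabilityMeasure (haarUnitary ι) :=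
  ⟨Measure.haarMeasure_self⟩

instance haarState_isProbabilityMeasure (N : ℕ) : IsProbabilityMeasure (haarState N) := by
  refine Measure.isProbabilityMeasure_map (Continuous.aemeasurable ?_)
  refine continuous_pi fun x => ?_
  exact (continuous_apply _).comp ((continuous_apply x).comp continuous_subtype_val)

end Haar

/-! ## Quantum circuits -/

/-- Wires are grouped into banks; within a bank they carry two numbers. The wires `(0, i, j)` hold
the input, the wires `(1, 0, j)` the output, and all other wires are workspace. -/
abbrev Wire := ℕ × ℕ × ℕ

/-- The wire of qubit `j` of copy `i` of the input. -/
def inWire (i j : ℕ) : Wire := (0, i, j)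

/-- The wire of output qubit `j`. -/
def outWire (j : ℕ) : Wire := (1, 0, j)

/-- A unitary gate placed on one wire or on two wires. -/
inductive Gate
  | one (U : Matrix.unitaryGroup Bool ℂ) (w : Wire)
  | two (U : Matrix.unitaryGroup (Bool × Bool) ℂ) (w w' : Wire)

/-- A circuit is the list of its gates, in the order of their application. -/
abbrev Circuit := List Gate

/-- Vectors of the wires: finite linear combinations of computational basis states. -/
abbrev Vec := (Wire → Bool) →₀ ℂ

/-- The action of a gate. A two-wire gate needs two different wires; otherwise it does nothing. -/
def Gate.apply : Gate → Vec →ₗ[ℂ] Vec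
  | .one U w => Finsupp.linearCombination ℂ fun f =>
      ∑ b : Bool, Finsupp.single (Function.update f w b) (U.1 b (f w))
  | .two U w w' => if w = w' then LinearMap.id else Finsupp.linearCombination ℂ fun f =>
      ∑ b : Bool × Bool,
        Finsupp.single (Function.update (Function.update f w b.1) w' b.2) (U.1 b (f w, f w'))

/-- The vector obtained from `v` by a run of the circuit. -/
def runCircuit (C : Circuit) (v : Vec) : Vec := C.foldl (fun u g => g.apply u) v

/-- The basis state with the bits `x` on the wires `inp` and with `0` on all other wires. -/
def load {ι : Type} (inp : ι → Wire) (x : ι → Bool) : Vec :=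
  Finsupp.single (Function.extend inp x fun _ => false) 1

open Classical in
/-- The partial trace of `|v⟩⟨u|` over all wires that are not in the range of `out`. -/
def reduced {o : Type} (out : o → Wire) (v u : Vec) : Op o :=
  Matrix.of fun a b => v.sum fun f z =>
    if f ∘ out = a then z * star (u (Function.extend out b f)) else 0

/-- The channel of a circuit: the operator `ρ` is put on the wires `inp`, all other wires start in
the state `0`, the gates are applied, and all wires except `out` are traced out. -/
def channel (C : Circuit) {ι o : Type} [Fintype ι] [DecidableEq ι]
    (inp : ι → Wire) (out : o → Wire) (ρ : Op ι) : Op o :=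
  ∑ x, ∑ y, ρ x y • reduced out (runCircuit C (load inp x)) (runCircuit C (load inp y))

/-- The state of `n` output qubits that a circuit prepares from `k` qubits of input. -/
def outputState (C : Circuit) {k : ℕ} (n : ℕ) (ρ : Op (Fin k)) : Op (Fin n) :=
  channel C (fun j : Fin k => inWire 0 j) (fun j : Fin n => outWire j) ρ

/-- The probability that a measurement of the first output qubit gives `1`, if the circuit runs on
an input that consists of `t` registers of `N` qubits. -/
def acceptProb (C : Circuit) {t N : ℕ} (ρ : Op (Fin t × Fin N)) : ℝ :=
  (channel C (fun q : Fin t × Fin N => inWire q.1 q.2) (fun _ : Unit => outWire 0) ρ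
    (fun _ => true) (fun _ => true)).re

/-! ## Efficient quantum algorithms: circuit families written by polynomial-time programs -/

/-- Programs over stacks of bits. They are deterministic; `gate1` and `gate2` append a gate to the
circuit that is written. The wire is given by a bank, which is fixed in the program, and by the
heights of two stacks. -/
inductive Prog
  | skip
  | push (b : Bool) (x : ℕ)
  | pop (x : ℕ)
  | copy (x y : ℕ)
  | gate1 (U : Matrix.unitaryGroup Bool ℂ) (b x y : ℕ)
  | gate2 (U : Matrix.unitaryGroup (Bool × Bool) ℂ) (b x y b' x' y' : ℕ)
  | seq (p q : Prog)
  | branch (x : ℕ) (pEmpty pFalse pTrue : Prog)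
  | loop (x : ℕ) (p : Prog)

/-- The contents of the stacks; the head of the list is the top of the stack. -/
abbrev Store := ℕ → List Bool

/-- The wire named by a bank and two stacks. -/
def wireOf (s : Store) (b x y : ℕ) : Wire := (b, (s x).length, (s y).length)

/-- `Exec p s C τ s'`: started with the stacks `s`, the program `p` halts after `τ` steps with the
stacks `s'`, and has then written the circuit `C`. -/
inductive Exec : Prog → Store → Circuit → ℕ → Store → Prop
  | skip (s) : Exec .skip s [] 1 s
  | push (b x s) : Exec (.push b x) s [] 1 (Function.update s x (b :: s x))
  | pop (x s) : Exec (.pop x) s [] 1 (Function.update s x (s x).tail)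
  | copy (x y s) : Exec (.copy x y) s [] 1 (Function.update s y (s x))
  | gate1 (U b x y s) : Exec (.gate1 U b x y) s [.one U (wireOf s b x y)] 1 s
  | gate2 (U b x y b' x' y' s) : Exec (.gate2 U b x y b' x' y') s
      [.two U (wireOf s b x y) (wireOf s b' x' y')] 1 s
  | seq {p q s s' s'' C C' τ τ'} : Exec p s C τ s' → Exec q s' C' τ' s'' →
      Exec (.seq p q) s (C ++ C') (τ + τ') s''
  | branchEmpty {x p q r s s' C τ} : s x = [] → Exec p s C τ s' →
      Exec (.branch x p q r) s C (τ + 1) s'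
  | branchFalse {x p q r s s' C τ l} : s x = false :: l → Exec q s C τ s' →
      Exec (.branch x p q r) s C (τ + 1) s'
  | branchTrue {x p q r s s' C τ l} : s x = true :: l → Exec r s C τ s' →
      Exec (.branch x p q r) s C (τ + 1) s'
  | loopDone {x p s} : s x = [] → Exec (.loop x p) s [] 1 s
  | loopStep {x p s s' s'' C C' τ τ'} : s x ≠ [] → Exec p s C τ s' →
      Exec (.loop x p) s' C' τ' s'' → Exec (.loop x p) s (C ++ C') (τ + τ' + 1) s''

/-- A set of elementary one-qubit and two-qubit gates. -/
structure GateSet where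
  one : Set (Matrix.unitaryGroup Bool ℂ)
  two : Set (Matrix.unitaryGroup (Bool × Bool) ℂ)

/-- All gates that occur in the program belong to the gate set. -/
def Prog.Uses (𝒢 : GateSet) : Prog → Prop
  | .gate1 U _ _ _ => U ∈ 𝒢.one
  | .gate2 U _ _ _ _ _ _ => U ∈ 𝒢.two
  | .seq p q => p.Uses 𝒢 ∧ q.Uses 𝒢
  | .branch _ p q r => p.Uses 𝒢 ∧ q.Uses 𝒢 ∧ r.Uses 𝒢
  | .loop _ p => p.Uses 𝒢
  | _ => True

/-- The stacks at the start: the parameters `n`, `m`, `κ` in unary. -/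
def initStore (n m κ : ℕ) : Store
  | 0 => List.replicate n true
  | 1 => List.replicate m true
  | 2 => List.replicate κ true
  | _ => []

/-- A quantum polynomial-time algorithm: a program that, given the public parameters
`1^n`, `1^m`, `1^κ`, writes within polynomially many steps a circuit over the gate set, together
with the circuits that it writes. -/
structure QPT (𝒢 : GateSet) where
  prog : Prog
  circuit : ℕ → ℕ → ℕ → Circuit
  uses : prog.Uses 𝒢
  polyTime : ∃ p : Polynomial ℕ, ∀ n m κ, ∃ τ s,
    Exec prog (initStore n m κ) (circuit n m κ) τ s ∧ τ ≤ p.eval (n + m + κ)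

/-- The Hadamard gate. -/
def hadamard : Matrix.unitaryGroup Bool ℂ :=
  ⟨Matrix.of fun a b => (if a && b then -1 else 1) * ((Real.sqrt 2 : ℝ) : ℂ)⁻¹, by
    have h : (((Real.sqrt 2 : ℝ) : ℂ)⁻¹) * (((Real.sqrt 2 : ℝ) : ℂ)⁻¹) = 1 / 2 := by
      rw [← mul_inv, ← Complex.ofReal_mul, Real.mul_self_sqrt (by norm_num)]
      norm_num
    rw [Matrix.mem_unitaryGroup_iff]
    ext a b
    cases a <;> cases b <;>
      (simp [Matrix.mul_apply, Matrix.star_apply, h]; try norm_num)⟩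

/-- The controlled-NOT gate; the first qubit is the control. -/
def cnot : Matrix.unitaryGroup (Bool × Bool) ℂ :=
  ⟨Matrix.of fun a b => if a = (b.1, xor b.1 b.2) then 1 else 0, by
    rw [Matrix.mem_unitaryGroup_iff]
    ext ⟨a, a'⟩ ⟨b, b'⟩
    cases a <;> cases a' <;> cases b <;> cases b' <;>
      simp [Matrix.mul_apply, Matrix.star_apply, Fintype.sum_prod_type]⟩

/-! ## Pseudorandom states, the mixed states built from them, and EFI pairs -/

/-- `f` is eventually smaller than every inverse power of the parameter `s`. -/
def Negligible (s : ℕ → ℕ) (f : ℕ → ℝ) : Prop :=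
  ∀ d : ℕ, ∀ᶠ n in atTop, f n < ((s n : ℝ) ^ d)⁻¹

/-- A family of pure states of `n + m n` qubits with keys of `κ n` bits. -/
abbrev KeyedStates (m κ : ℕ → ℕ) :=
  ∀ n, (Fin (κ n) → Bool) → (Fin (n + m n) → Bool) → ℂ

/-- The average of `f` over a uniformly random key of `κ` bits. -/
def keyAverage {E : Type} [AddCommMonoid E] [Module ℝ E] {κ : ℕ} (f : (Fin κ → Bool) → E) : E :=
  ((2 : ℝ) ^ κ)⁻¹ • ∑ k, f k

/-- Pseudorandom states of `n + m n` qubits with keys of `κ n` bits. -/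
structure IsPRS (𝒢 : GateSet) (m κ : ℕ → ℕ) (ψ : KeyedStates m κ) : Prop where
  normalized : ∀ n k, ∑ x, ‖ψ n k x‖ ^ 2 = 1
  /-- There is an efficient algorithm that prepares `|ψ_k⟩` from the key `k`. -/
  efficient : ∃ G : QPT 𝒢, ∀ n k,
    outputState (G.circuit n (m n) (κ n)) (n + m n) (basisState k) = pureState (ψ n k)
  /-- No efficient algorithm tells polynomially many copies of `|ψ_k⟩`, for a random key, from as
  many copies of a Haar random state. -/
  pseudorandom : ∀ (A : QPT 𝒢) (t : Polynomial ℕ), Negligible id fun n =>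
    |keyAverage (fun k =>
        acceptProb (A.circuit n (m n) (κ n)) (copies (t.eval n) (pureState (ψ n k))))
      - ∫ φ, acceptProb (A.circuit n (m n) (κ n)) (copies (t.eval n) (pureState φ))
          ∂(haarState (n + m n))|

/-- The member with key `k` of the ensemble obtained by tracing out `m n` qubits. -/
def prdm {m κ : ℕ → ℕ} (ψ : KeyedStates m κ) (n : ℕ) (k : Fin (κ n) → Bool) : Op (Fin n) :=
  traceLast (pureState (ψ n k))

/-- The `n`-qubit state of that ensemble for somebody who does not know the key. -/
def prdmState {m κ : ℕ → ℕ} (ψ : KeyedStates m κ) (n : ℕ) : Op (Fin n) :=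
  keyAverage (prdm ψ n)

/-- The states `ν b n` of `n` qubits form an EFI pair with security parameter `κ n`. All algorithms
are given `1^n`, `1^(m n)` and `1^(κ n)`. -/
structure IsEFI (𝒢 : GateSet) (m κ : ℕ → ℕ) (ν : Bool → ∀ n, Op (Fin n)) : Prop where
  efficient : ∀ b, ∃ G : QPT 𝒢, ∀ n,
    outputState (G.circuit n (m n) (κ n)) n (1 : Op (Fin 0)) = ν b n
  far : ∃ p : Polynomial ℕ, ∀ᶠ n in atTop,
    1 ≤ ((p.eval (κ n) : ℕ) : ℝ) * traceNorm (ν false n - ν true n)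
  indistinguishable : ∀ A : QPT 𝒢, Negligible κ fun n =>
    |acceptProb (A.circuit n (m n) (κ n)) (copies 1 (ν false n))
      - acceptProb (A.circuit n (m n) (κ n)) (copies 1 (ν true n))|

/-- The pair of two families of states. -/
def pair (ν₀ ν₁ : ∀ n, Op (Fin n)) (b : Bool) (n : ℕ) : Op (Fin n) :=
  if b then ν₁ n else ν₀ n

/-! ## Mixed unitary channels -/

/-- A mixed unitary channel on `n` qubits, given by its weights and its unitaries. -/
structure MixedUnitary (n : ℕ) where
  r : ℕ
  weight : Fin r → ℝ
  unitary : Fin r → Matrix.unitaryGroup (Fin n → Bool) ℂ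
  weight_nonneg : ∀ i, 0 ≤ weight i
  weight_sum : ∑ i, weight i = 1

/-- The action `ρ ↦ ∑ i, p_i U_i ρ U_i†`. -/
def MixedUnitary.map {n : ℕ} (Φ : MixedUnitary n) (ρ : Op (Fin n)) : Op (Fin n) :=
  ∑ i, Φ.weight i • ((Φ.unitary i).1 * ρ * star (Φ.unitary i).1)

/-- The Shannon entropy of the weights, in bits. -/
def MixedUnitary.entropy {n : ℕ} (Φ : MixedUnitary n) : ℝ :=
  -∑ i, Φ.weight i * Real.logb 2 (Φ.weight i)

/-- The channels of the family are carried out by an efficient quantum algorithm. -/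
def IsEfficientFamily (𝒢 : GateSet) (m κ : ℕ → ℕ) (Φ : ∀ n, MixedUnitary n) : Prop :=
  ∃ F : QPT 𝒢, ∀ n (ρ : Op (Fin n)),
    outputState (F.circuit n (m n) (κ n)) n ρ = (Φ n).map ρ

end

end QCrypto

open QCrypto

namespace QCrypto

noncomputable section

/-! All three regimes are instances of `IsPRS.isEFI_map`, whose quantitative input is H ≤ n − κ − m
− 2 for the entropy H of the weights; regime 1 uses the identity channel, with H = 0.

Preparation: half of each of κ Bell pairs gives a uniformly mixed key. Feeding it to the generator,
reading only n output qubits and running Φ prepares Φ(ν₀). Since Φ is unital, Φ(ν₁) = I/2^n, which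
is again made of halves of Bell pairs. The work lies in composing algorithms (`channel_compCircuit`,
`QPT.comp`): the two circuits must live on disjoint wires and the two programs on disjoint stacks.

Indistinguishability: one copy suffices. The Haar average of |φ⟩⟨φ| is I/2^(n+m), whose partial
trace is I/2^n, so a distinguisher of Φ(ν₀) and Φ(ν₁), preceded by Φ and by the partial trace, would
break the PRS.

Distance: ν₀ has rank at most 2^(κ+m). For a set S of indices, test on the span of the supports of
U_i ν₀ U_i† with i ∈ S. With N = n − κ − m and T the trace norm of the difference, this yields
Σ_{i∈S} p_i ≤ |S|/2^N + T (`sum_weight_le_of_prdmState`). Thus if T is small, no few indices carry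
much weight, which forces the entropy up to nearly N; quantitatively, H ≤ N − 2 implies N·T ≥ 1/4
(`entropy_layer_bound`). As N ≤ n = O(κ + 1), T is at least an inverse polynomial in κ. -/

/-! ### The partial trace as a sesquilinear map. -/

open Classical in
theorem reduced_single {o : Type} (out : o → Wire) (f g : Wire → Bool) (z w : ℂ) (a b : o → Bool) :
    reduced out (Finsupp.single f z) (Finsupp.single g w) a b =
      if f ∘ out = a ∧ g = Function.extend out b f then z * star w else 0 := by
  simp only [reduced, Matrix.of_apply]
  rw [Finsupp.sum_single_index (by simp)]
  by_cases h1 : f ∘ out = a <;> by_cases h2 : g = Function.extend out b f <;>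
    simp [h1, h2]

/-- The partial trace of `|v⟩⟨u|` as a sesquilinear map. -/
def reducedₛₗ {o : Type} (out : o → Wire) : Vec →ₗ[ℂ] Vec →ₛₗ[starRingEnd ℂ] Op o :=
  LinearMap.mk₂'ₛₗ (RingHom.id ℂ) (starRingEnd ℂ) (reduced out)
    (fun v v' u => by
      ext a b
      simp only [reduced, Matrix.of_apply, Matrix.add_apply]
      refine Finsupp.sum_add_index' (by simp) fun f z z' => ?_
      split_ifs <;> simp [add_mul])
    (fun c v u => by
      ext a b
      simp only [reduced, Matrix.of_apply, Matrix.smul_apply]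
      rw [Finsupp.sum_smul_index' (by simp), Finsupp.smul_sum]
      refine Finsupp.sum_congr fun f _ => ?_
      split_ifs <;> simp [mul_assoc])
    (fun v u u' => by
      ext a b
      simp only [reduced, Matrix.of_apply, Matrix.add_apply]
      rw [← Finsupp.sum_add]
      refine Finsupp.sum_congr fun f _ => ?_
      split_ifs <;> simp [mul_add])
    (fun c v u => by
      ext a b
      simp only [reduced, Matrix.of_apply, Matrix.smul_apply]
      rw [Finsupp.smul_sum]
      refine Finsupp.sum_congr fun f _ => ?_
      split_ifs <;> simp [mul_left_comm])

theorem reducedₛₗ_apply {o : Type} (out : o → Wire) (v u : Vec) :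
    reducedₛₗ out v u = reduced out v u := rfl

/-! ## Runs of circuits -/

theorem runCircuit_append (C D : Circuit) (v : Vec) :
    runCircuit (C ++ D) v = runCircuit D (runCircuit C v) := by
  simp [runCircuit, List.foldl_append]

theorem runCircuit_cons (g : Gate) (C : Circuit) (v : Vec) :
    runCircuit (g :: C) v = runCircuit C (g.apply v) := rfl

/-- The action of a circuit as a linear map. -/
def runLinear (C : Circuit) : Vec →ₗ[ℂ] Vec where
  toFun := runCircuit C
  map_add' := by
    induction C with
    | nil => intro v u; rfl
    | cons g C ih => intro v u; simp only [runCircuit_cons, map_add, ih]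
  map_smul' := by
    induction C with
    | nil => intro v u; rfl
    | cons g C ih =>
      intro v u
      simp only [runCircuit_cons, map_smul]
      exact ih _ _

theorem runLinear_apply (C : Circuit) (v : Vec) : runLinear C v = runCircuit C v := rfl

/-! ## Renaming of wires -/

/-- The gate with renamed wires. -/
def Gate.rename (e : Wire → Wire) : Gate → Gate
  | .one U w => .one U (e w)
  | .two U w w' => .two U (e w) (e w')

theorem extend_update {e : Wire → Wire} (he : e.Injective) (h f : Wire → Bool) (w : Wire)
    (b : Bool) :
    Function.update (Function.extend e h f) (e w) b = Function.extend e (Function.update h w b) f := by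
  funext u
  by_cases hu : ∃ t, e t = u
  · obtain ⟨t, rfl⟩ := hu
    simp [Function.update_apply, he.extend_apply, he.eq_iff]
  · have : u ≠ e w := fun h => hu ⟨w, h.symm⟩
    simp [this, Function.extend_apply' _ _ _ hu]

/-- The map `fun h => Function.extend e h f` embeds a register as the wires in the range of `e`,
with the bits `f` frozen on all others; renamed gates never touch the frozen part. -/
theorem Gate.apply_rename {e : Wire → Wire} (he : e.Injective) (f : Wire → Bool) (g : Gate)
    (v : Vec) :
    (g.rename e).apply (v.mapDomain fun h => Function.extend e h f) =
      (g.apply v).mapDomain fun h => Function.extend e h f := by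
  induction v using Finsupp.induction_linear with
  | zero => simp
  | add v u hv hu => simp only [Finsupp.mapDomain_add, map_add, hv, hu]
  | single h z =>
    cases g with
    | one U w =>
      simp only [Gate.rename, Gate.apply, Finsupp.mapDomain_single,
        Finsupp.linearCombination_single, Finsupp.mapDomain_smul, Finsupp.mapDomain_finsetSum,
        he.extend_apply, extend_update he]
    | two U w w' =>
      by_cases hw : w = w'
      · simp [Gate.rename, Gate.apply, hw, Finsupp.mapDomain_single]
      · simp only [Gate.rename, Gate.apply, hw, he.eq_iff, if_false, Finsupp.mapDomain_single,
          Finsupp.linearCombination_single, Finsupp.mapDomain_smul, Finsupp.mapDomain_finsetSum,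
          he.extend_apply, extend_update he]

theorem runCircuit_rename {e : Wire → Wire} (he : e.Injective) (f : Wire → Bool) (C : Circuit)
    (v : Vec) :
    runCircuit (C.map (Gate.rename e)) (v.mapDomain fun h => Function.extend e h f) =
      (runCircuit C v).mapDomain fun h => Function.extend e h f := by
  induction C generalizing v with
  | nil => rfl
  | cons g C ih => simp only [List.map_cons, runCircuit_cons, Gate.apply_rename he, ih]

theorem extend_extend {o : Type} {e : Wire → Wire} (he : e.Injective) {out : o → Wire}
    (ho : out.Injective) (heo : ∀ i, e (out i) = out i) (b : o → Bool) (h f : Wire → Bool) :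
    Function.extend out b (Function.extend e h f) = Function.extend e (Function.extend out b h) f := by
  funext u
  by_cases hu : ∃ t, e t = u
  · obtain ⟨t, rfl⟩ := hu
    rw [he.extend_apply]
    by_cases ht : ∃ i, out i = t
    · obtain ⟨i, rfl⟩ := ht
      rw [ho.extend_apply, heo, ho.extend_apply]
    · have : ¬ ∃ i, out i = e t := fun ⟨i, hi⟩ => ht ⟨i, he ((heo i).trans hi)⟩
      rw [Function.extend_apply' _ _ _ ht, Function.extend_apply' _ _ _ this, he.extend_apply]
  · have : ¬ ∃ i, out i = u := fun ⟨i, hi⟩ => hu ⟨out i, (heo i).trans hi⟩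
    rw [Function.extend_apply' _ _ _ hu, Function.extend_apply' _ _ _ this,
      Function.extend_apply' _ _ _ hu]

theorem extend_eq_extend_iff {e : Wire → Wire} (he : e.Injective) (h h' f f' : Wire → Bool) :
    Function.extend e h f = Function.extend e h' f' ↔
      h = h' ∧ ∀ w, w ∉ Set.range e → f w = f' w := by
  constructor
  · intro H
    refine ⟨funext fun t => ?_, fun w hw => ?_⟩
    · simpa [he.extend_apply] using congrFun H (e t)
    · simpa [Function.extend_apply' _ _ _ hw] using congrFun H w
  · rintro ⟨rfl, H⟩
    funext u
    by_cases hu : ∃ t, e t = u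
    · obtain ⟨t, rfl⟩ := hu
      simp [he.extend_apply]
    · simp [Function.extend_apply' _ _ _ hu, H u hu]

-- All output wires lie in the embedded part, so the frozen bits are traced out and contribute only
-- the inner product of two basis states, which is 1 or 0.
open Classical in
theorem reduced_mapDomain_extend {o : Type} {e : Wire → Wire} (he : e.Injective) {out : o → Wire}
    (ho : out.Injective) (heo : ∀ i, e (out i) = out i) (f f' : Wire → Bool) (v u : Vec) :
    reduced out (v.mapDomain fun h => Function.extend e h f)
        (u.mapDomain fun h => Function.extend e h f') =
      if ∀ w, w ∉ Set.range e → f w = f' w then reduced out v u else 0 := by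
  simp only [← reducedₛₗ_apply]
  induction v using Finsupp.induction_linear with
  | zero => simp
  | add v v' hv hv' =>
    simp only [Finsupp.mapDomain_add, map_add, LinearMap.add_apply, hv, hv']
    split_ifs <;> simp
  | single h z =>
    induction u using Finsupp.induction_linear with
    | zero => simp
    | add v v' hv hv' =>
      simp only [Finsupp.mapDomain_add, map_add, hv, hv']
      split_ifs <;> simp
    | single h' z' =>
      ext a b
      have h1 : (Function.extend e h f) ∘ out = h ∘ out := by
        funext i
        rw [Function.comp_apply, ← heo, he.extend_apply, Function.comp_apply]
      simp only [Finsupp.mapDomain_single, reducedₛₗ_apply, reduced_single, h1,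
        extend_extend he ho heo, extend_eq_extend_iff he, eq_comm (a := f' _), eq_comm (a := h')]
      by_cases H : ∀ w, w ∉ Set.range e → f w = f' w
      · rw [if_pos H, reduced_single]
        exact if_congr (by rw [and_iff_left H, eq_comm (a := h')]) rfl rfl
      · rw [if_neg H, if_neg (fun h => H h.2.2)]
        rfl

/-! ## Layers of swaps -/

theorem cnot_apply {w w' : Wire} (hw : w ≠ w') (v : Vec) :
    (Gate.two cnot w w').apply v =
      v.mapDomain fun f => Function.update f w' (xor (f w) (f w')) := by
  induction v using Finsupp.induction_linear with
  | zero => simp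
  | add v u hv hu => simp only [Finsupp.mapDomain_add, map_add, hv, hu]
  | single f z =>
    simp only [Gate.apply, hw, if_false, Finsupp.linearCombination_single, Finsupp.mapDomain_single]
    rw [Finset.sum_eq_single (f w, xor (f w) (f w'))]
    · simp [cnot]
    · intro b _ hb
      simp [cnot, hb]
    · simp

/-- The exchange of two wires by three CNOT gates. -/
def swapGates (w w' : Wire) : Circuit := [.two cnot w w', .two cnot w' w, .two cnot w w']

/-- The exchange of the first `k` wires of two banks. -/
def swapLayer (b b' : ℕ) : ℕ → Circuit
  | 0 => []
  | k + 1 => swapGates (b, 0, k) (b', 0, k) ++ swapLayer b b' k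

/-- The effect of `swapLayer` on a computational basis state. -/
def swapFun (b b' k : ℕ) (f : Wire → Bool) (w : Wire) : Bool :=
  if w.2.1 = 0 ∧ w.2.2 < k then
    if w.1 = b then f (b', w.2) else if w.1 = b' then f (b, w.2) else f w
  else f w

theorem runCircuit_swapGates {w w' : Wire} (hw : w ≠ w') (v : Vec) :
    runCircuit (swapGates w w') v =
      v.mapDomain fun f => Function.update (Function.update f w (f w')) w' (f w) := by
  simp only [swapGates, runCircuit_cons, cnot_apply hw, cnot_apply hw.symm]
  rw [← Finsupp.mapDomain_comp, ← Finsupp.mapDomain_comp]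
  show Finsupp.mapDomain _ v = _
  congr 1
  funext f u
  by_cases h1 : u = w <;> by_cases h2 : u = w'
  · exact absurd (h1.symm.trans h2) hw
  · subst h1
    cases hu : f u <;> cases hu' : f w' <;> simp [h2, hu, hu', hw.symm]
  · subst h2
    cases hu : f u <;> cases hu' : f w <;> simp [hu, hu', hw, hw.symm]
  · simp [h1, h2]

theorem runCircuit_swapLayer {b b' : ℕ} (hb : b ≠ b') (k : ℕ) (v : Vec) :
    runCircuit (swapLayer b b' k) v = v.mapDomain (swapFun b b' k) := by
  induction k generalizing v with
  | zero =>
    have : swapFun b b' 0 = id := by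
      funext f w
      simp [swapFun]
    rw [this, Finsupp.mapDomain_id]
    rfl
  | succ k ih =>
    have hw : ((b, 0, k) : Wire) ≠ (b', 0, k) := fun h => hb (Prod.ext_iff.1 h).1
    rw [swapLayer, runCircuit_append, ih, runCircuit_swapGates hw, ← Finsupp.mapDomain_comp]
    congr 1
    funext f ⟨c, i, j⟩
    simp only [swapFun, Function.comp_apply, Function.update_apply, Prod.mk.injEq]
    grind

/-! ## Composition of channels -/

/-- Both sides are sesquilinear, so basis vectors suffice. There `reduced` is a single matrix unit
or zero, according to whether the bits off `out` agree; `R a b` is the image of the matrix unit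
|a⟩⟨b| under the second channel. -/
theorem channel_comp_aux {k : ℕ} {o : Type} (R : (Fin k → Bool) → (Fin k → Bool) → Op o)
    (B : Vec →ₗ[ℂ] Vec →ₛₗ[starRingEnd ℂ] Op o) (T : Vec →ₗ[ℂ] Vec)
    {out : Fin k → Wire} (ho : out.Injective)
    (h1 : ∀ f g, (∀ w, w ∉ Set.range out → f w = g w) →
      B (T (Finsupp.single f 1)) (T (Finsupp.single g 1)) = R (f ∘ out) (g ∘ out))
    (h0 : ∀ f g, ¬ (∀ w, w ∉ Set.range out → f w = g w) →
      B (T (Finsupp.single f 1)) (T (Finsupp.single g 1)) = 0) (v u : Vec) :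
    B (T v) (T u) = ∑ a, ∑ b, reduced out v u a b • R a b := by
  classical
  simp only [← reducedₛₗ_apply]
  induction v using Finsupp.induction_linear with
  | zero => simp
  | add v v' hv hv' =>
    simp only [map_add, LinearMap.add_apply, hv, hv', Matrix.add_apply, add_smul,
      Finset.sum_add_distrib]
  | single f z =>
    induction u using Finsupp.induction_linear with
    | zero => simp
    | add v v' hv hv' =>
      simp only [map_add, hv, hv', Matrix.add_apply, add_smul, Finset.sum_add_distrib]
    | single g z' =>
      have e1 : Finsupp.single f z = z • Finsupp.single f (1 : ℂ) := by simp
      have e2 : Finsupp.single g z' = z' • Finsupp.single g (1 : ℂ) := by simp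
      have key : ∀ a b : Fin k → Bool, (f ∘ out = a ∧ g = Function.extend out b f) ↔
          ((∀ w, w ∉ Set.range out → f w = g w) ∧ f ∘ out = a ∧ g ∘ out = b) := by
        intro a b
        constructor
        · rintro ⟨h, rfl⟩
          refine ⟨fun w hw => (Function.extend_apply' _ _ _ hw).symm, h, ?_⟩
          funext i
          simp [ho.extend_apply]
        · rintro ⟨h, h', rfl⟩
          refine ⟨h', funext fun w => ?_⟩
          by_cases hw : ∃ i, out i = w
          · obtain ⟨i, rfl⟩ := hw
            simp [ho.extend_apply]
          · rw [Function.extend_apply' _ _ _ hw, h w hw]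
      simp only [reducedₛₗ_apply, reduced_single, key]
      rw [e1, e2]
      simp only [map_smul, LinearMap.smul_apply, LinearMap.map_smulₛₗ]
      by_cases H : ∀ w, w ∉ Set.range out → f w = g w
      · rw [h1 _ _ H]
        simp only [eq_true H, true_and]
        rw [Finset.sum_eq_single (f ∘ out), Finset.sum_eq_single (g ∘ out)]
        · simp [smul_smul, mul_comm]
        · intro b _ hb
          rw [if_neg (fun h => hb h.2.symm), zero_smul]
        · simp
        · intro b _ hb
          refine Finset.sum_eq_zero fun c _ => ?_
          rw [if_neg (fun h => hb h.1.symm), zero_smul]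
        · simp
      · rw [h0 _ _ H]
        simp only [H, false_and, if_false, zero_smul, smul_zero, Finset.sum_const_zero]

/-- The renaming of wires that acts on the banks. -/
def mapBank (β : ℕ → ℕ) (w : Wire) : Wire := (β w.1, w.2)

theorem mapBank_injective {β : ℕ → ℕ} (hβ : β.Injective) : (mapBank β).Injective := by
  rintro ⟨a, b⟩ ⟨c, d⟩ h
  simp only [mapBank, Prod.mk.injEq] at h
  rw [hβ h.1, h.2]

/-- The banks for the first one of two circuits in a composition. -/
def bankFst (b : ℕ) : ℕ := 3 * b

/-- The banks for the second one of two circuits in a composition. -/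
def bankSnd (b : ℕ) : ℕ := if b = 0 then 2 else 3 * b - 2

theorem bankFst_injective : bankFst.Injective := fun a b h => by
  simp only [bankFst] at h
  omega

theorem bankSnd_injective : bankSnd.Injective := fun a b h => by
  simp only [bankSnd] at h
  split_ifs at h <;> omega

/-- The circuit that applies `P`, and then `Q` to `k` output qubits of `P`. -/
def compCircuit (k : ℕ) (P Q : Circuit) : Circuit :=
  P.map (Gate.rename (mapBank bankFst)) ++ swapLayer 3 2 k ++
    Q.map (Gate.rename (mapBank bankSnd))

theorem outWire_injective (k : ℕ) : (fun j : Fin k => outWire j).Injective := fun a b h => by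
  simp only [outWire, Prod.mk.injEq] at h
  exact Fin.ext h.2.2

theorem inWire_injective (k : ℕ) : (fun j : Fin k => inWire 0 j).Injective := fun a b h => by
  simp only [inWire, Prod.mk.injEq] at h
  exact Fin.ext h.2.2

/-- `P` occupies the banks divisible by 3 and `Q` occupies bank 2 and the banks congruent to 1. The
input of `P` stays in bank 0 and the output of `Q` in bank 1, while the output of `P` lands in bank
3 and the input of `Q` in bank 2, hence the swap of these two. -/
theorem channel_compCircuit (k : ℕ) (P Q : Circuit) {ι o : Type} [Fintype ι] [DecidableEq ι]
    (inp : ι → Wire) (hinp : inp.Injective) (hinp0 : ∀ i, (inp i).1 = 0) (out : o → Wire)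
    (hout : out.Injective) (hout1 : ∀ i, (out i).1 = 1) (ρ : Op ι) :
    channel (compCircuit k P Q) inp out ρ =
      channel Q (fun j : Fin k => inWire 0 j) out (channel P inp (fun j : Fin k => outWire j) ρ) := by
  classical
  set e := mapBank bankFst with he_def
  set e' := mapBank bankSnd with he'_def
  have he : e.Injective := mapBank_injective bankFst_injective
  have he' : e'.Injective := mapBank_injective bankSnd_injective
  set z : Wire → Bool := fun _ => false with hz
  set inQ := fun j : Fin k => inWire 0 j with hinQ
  set outP := fun j : Fin k => outWire j with houtP
  have hein : ∀ i, e (inp i) = inp i := fun i => by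
    have := hinp0 i
    ext <;> simp [he_def, mapBank, bankFst, this]
  have heout : ∀ i, e' (out i) = out i := fun i => by
    have := hout1 i
    ext <;> simp [he'_def, mapBank, bankSnd, this]
  -- the first circuit
  have hP : ∀ x, runCircuit (P.map (Gate.rename e)) (load inp x) =
      (runCircuit P (load inp x)).mapDomain fun h => Function.extend e h z := by
    intro x
    rw [← runCircuit_rename he]
    congr 1
    simp only [load, Finsupp.mapDomain_single]
    congr 1
    rw [← extend_extend he hinp hein]
    congr 1
    funext w
    by_cases hw : ∃ t, e t = w
    · obtain ⟨t, rfl⟩ := hw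
      rw [he.extend_apply]
    · rw [Function.extend_apply' _ _ _ hw]
  -- the rest of the run, on the basis states of the first circuit
  set G : (Wire → Bool) → (Wire → Bool) := fun f => swapFun 3 2 k (Function.extend e f z) with hG
  have hGf : ∀ f w, Function.extend e f z w =
      if w.1 % 3 = 0 then f (w.1 / 3, w.2) else false := by
    rintro f ⟨b, w⟩
    by_cases hb : b % 3 = 0
    · have : ((b, w) : Wire) = e (b / 3, w) := by
        simp only [he_def, mapBank, bankFst, Prod.mk.injEq, and_true]
        omega
      rw [this, he.extend_apply, ← this, if_pos hb]
    · rw [Function.extend_apply', if_neg hb]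
      rintro ⟨⟨c, u⟩, h⟩
      simp only [he_def, mapBank, bankFst, Prod.mk.injEq] at h
      omega
  set T : Vec →ₗ[ℂ] Vec := runLinear (Q.map (Gate.rename e')) ∘ₗ runLinear (swapLayer 3 2 k) ∘ₗ
    Finsupp.lmapDomain ℂ ℂ (fun h => Function.extend e h z) with hT
  have hTs : ∀ f, T (Finsupp.single f 1) =
      (runCircuit Q (load inQ (f ∘ outP))).mapDomain fun h => Function.extend e' h (G f) := by
    intro f
    rw [← runCircuit_rename he']
    simp only [hT, LinearMap.comp_apply, Finsupp.lmapDomain_apply, runLinear_apply,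
      runCircuit_swapLayer (show 3 ≠ 2 by norm_num), Finsupp.mapDomain_single, load]
    congr 2
    funext w
    by_cases hw : ∃ t, e' t = w
    · obtain ⟨t, rfl⟩ := hw
      rw [he'.extend_apply]
      by_cases ht : ∃ j, inQ j = t
      · obtain ⟨j, rfl⟩ := ht
        rw [(inWire_injective k).extend_apply]
        simp [swapFun, he'_def, hinQ, inWire, mapBank, bankSnd, hGf, houtP, outWire]
      · rw [Function.extend_apply' _ _ _ ht]
        obtain ⟨b, i, j⟩ := t
        have h0 : ¬ (b = 0 ∧ i = 0 ∧ j < k) := fun h =>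
          ht ⟨⟨j, h.2.2⟩, by simp [hinQ, inWire, h.1, h.2.1]⟩
        simp only [swapFun, he'_def, mapBank, bankSnd, hGf]
        by_cases hb : b = 0
        · rw [if_neg (fun h => h0 ⟨hb, h⟩)]
          simp [hb]
        · have : (3 * b - 2) % 3 = 1 := by omega
          have h3 : 3 * b - 2 ≠ 3 := by omega
          have h2 : 3 * b - 2 ≠ 2 := by omega
          simp [hb, this, h3, h2]
    · rw [Function.extend_apply' _ _ _ hw]
  -- Outside the wires of `Q`, the bits `G f` record exactly the bits of `f` that are not handed
  -- over: after the swap the first `k` wires of bank 3 hold zeros.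
  have hGG : ∀ f g, (∀ w, w ∉ Set.range e' → G f w = G g w) ↔
      ∀ w, w ∉ Set.range outP → f w = g w := by
    intro f g
    constructor
    · rintro H ⟨b, i, j⟩ hw
      have h1 : ((3 * b, i, j) : Wire) ∉ Set.range e' := by
        rintro ⟨⟨c, u⟩, h⟩
        simp only [he'_def, mapBank, bankSnd, Prod.mk.injEq] at h
        split_ifs at h <;> omega
      have h2 : ¬ (b = 1 ∧ i = 0 ∧ j < k) := fun h =>
        hw ⟨⟨j, h.2.2⟩, by simp [houtP, outWire, h.1, h.2.1]⟩
      have h3 : 3 * b ≠ 2 := by omega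
      have h4 : 3 * b = 3 ↔ b = 1 := by omega
      have := H _ h1
      simp only [hG, swapFun, hGf] at this
      by_cases hij : i = 0 ∧ j < k
      · have hb : b ≠ 1 := fun h => h2 ⟨h, hij⟩
        simpa [hij, h3, h4, hb] using this
      · simpa [hij] using this
    · rintro H ⟨b, i, j⟩ hw
      have hb2 : b ≠ 2 := fun h => hw ⟨(0, i, j), by simp [he'_def, mapBank, bankSnd, h]⟩
      simp only [hG, swapFun, hGf]
      have H' : ¬ (b = 3 ∧ i = 0 ∧ j < k) → b % 3 = 0 → f (b / 3, i, j) = g (b / 3, i, j) := by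
        intro h h3
        refine H _ ?_
        rintro ⟨t, ht⟩
        simp only [houtP, outWire, Prod.mk.injEq] at ht
        exact h ⟨by omega, ht.2.1.symm, ht.2.2 ▸ t.2⟩
      by_cases hij : i = 0 ∧ j < k
      · by_cases hb : b = 3
        · simp [hij, hb]
        · by_cases hb3 : b % 3 = 0
          · simp only [if_pos hij, hb, hb2, hb3, if_false, if_true]
            exact H' (fun h => hb h.1) hb3
          · simp [hij, hb, hb2, hb3]
      · by_cases hb3 : b % 3 = 0
        · simp only [hij, hb3, if_false, if_true, H' (fun h => hij h.2) hb3]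
        · simp [hij, hb3]
  have main : ∀ x y, reduced out (runCircuit (compCircuit k P Q) (load inp x))
      (runCircuit (compCircuit k P Q) (load inp y)) =
      ∑ a, ∑ b, reduced outP (runCircuit P (load inp x)) (runCircuit P (load inp y)) a b •
        reduced out (runCircuit Q (load inQ a)) (runCircuit Q (load inQ b)) := by
    intro x y
    have hrun : ∀ x, runCircuit (compCircuit k P Q) (load inp x) =
        T (runCircuit P (load inp x)) := by
      intro x
      simp only [compCircuit, runCircuit_append, ← he_def, ← he'_def, hP, hT, LinearMap.comp_apply, runLinear_apply,
        Finsupp.lmapDomain_apply]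
    rw [hrun, hrun, ← reducedₛₗ_apply]
    refine channel_comp_aux _ (reducedₛₗ out) T (outWire_injective k) ?_ ?_ _ _
    · intro f g h
      rw [hTs, hTs, reducedₛₗ_apply, reduced_mapDomain_extend he' hout heout,
        if_pos ((hGG f g).2 h)]
    · intro f g h
      rw [hTs, hTs, reducedₛₗ_apply, reduced_mapDomain_extend he' hout heout,
        if_neg (fun h' => h ((hGG f g).1 h'))]
  simp only [channel, main, Matrix.sum_apply, Matrix.smul_apply, Finset.sum_smul, Finset.smul_sum,
    smul_smul, smul_eq_mul]
  calc _ = ∑ x, ∑ a, ∑ y, ∑ b, _ := Finset.sum_congr rfl fun x _ => Finset.sum_comm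
    _ = ∑ a, ∑ x, ∑ y, ∑ b, _ := Finset.sum_comm
    _ = ∑ a, ∑ x, ∑ b, ∑ y, _ := Finset.sum_congr rfl fun a _ => Finset.sum_congr rfl
        fun x _ => Finset.sum_comm
    _ = _ := Finset.sum_congr rfl fun a _ => Finset.sum_comm

/-! ## Renaming of stacks and banks in programs -/

/-- The program with stacks renamed by `σ` and banks renamed by `β`. -/
def Prog.rename (σ β : ℕ → ℕ) : Prog → Prog
  | .skip => .skip
  | .push b x => .push b (σ x)
  | .pop x => .pop (σ x)
  | .copy x y => .copy (σ x) (σ y)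
  | .gate1 U b x y => .gate1 U (β b) (σ x) (σ y)
  | .gate2 U b x y b' x' y' => .gate2 U (β b) (σ x) (σ y) (β b') (σ x') (σ y')
  | .seq p q => .seq (p.rename σ β) (q.rename σ β)
  | .branch x p q r => .branch (σ x) (p.rename σ β) (q.rename σ β) (r.rename σ β)
  | .loop x p => .loop (σ x) (p.rename σ β)

theorem Prog.uses_rename {𝒢 : GateSet} (σ β : ℕ → ℕ) {p : Prog} (h : p.Uses 𝒢) :
    (p.rename σ β).Uses 𝒢 := by
  induction p with
  | seq p q ihp ihq => exact ⟨ihp h.1, ihq h.2⟩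
  | branch x p q r ihp ihq ihr => exact ⟨ihp h.1, ihq h.2.1, ihr h.2.2⟩
  | loop x p ih => exact ih h
  | _ => exact h

/-- Injectivity of `σ` keeps stack updates from colliding. Banks never influence the control flow,
so `β` is arbitrary. Leaving the other stacks untouched is what lets two programs share a store. -/
theorem Exec.rename {σ : ℕ → ℕ} (hσ : σ.Injective) (β : ℕ → ℕ) {p : Prog} {s s' : Store}
    {C : Circuit} {τ : ℕ} (h : Exec p s C τ s') (S : Store) (hS : ∀ x, S (σ x) = s x) :
    ∃ S' : Store, Exec (p.rename σ β) S (C.map (Gate.rename (mapBank β))) τ S' ∧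
      (∀ x, S' (σ x) = s' x) ∧ ∀ y, y ∉ Set.range σ → S' y = S y := by
  induction h generalizing S with
  | skip s => exact ⟨S, .skip S, hS, fun _ _ => rfl⟩
  | push b x s =>
    refine ⟨_, .push b (σ x) S, fun y => ?_, fun y hy => ?_⟩
    · simp [Function.update_apply, hσ.eq_iff, hS]
    · have : y ≠ σ x := fun h => hy ⟨x, h.symm⟩
      simp [this]
  | pop x s =>
    refine ⟨_, .pop (σ x) S, fun y => ?_, fun y hy => ?_⟩
    · simp [Function.update_apply, hσ.eq_iff, hS]
    · have : y ≠ σ x := fun h => hy ⟨x, h.symm⟩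
      simp [this]
  | copy x z s =>
    refine ⟨_, .copy (σ x) (σ z) S, fun y => ?_, fun y hy => ?_⟩
    · simp [Function.update_apply, hσ.eq_iff, hS]
    · have : y ≠ σ z := fun h => hy ⟨z, h.symm⟩
      simp [this]
  | gate1 U b x y s =>
    refine ⟨S, ?_, hS, fun _ _ => rfl⟩
    have := Exec.gate1 U (β b) (σ x) (σ y) S
    simpa [Prog.rename, Gate.rename, wireOf, hS, mapBank] using this
  | gate2 U b x y b' x' y' s =>
    refine ⟨S, ?_, hS, fun _ _ => rfl⟩
    have := Exec.gate2 U (β b) (σ x) (σ y) (β b') (σ x') (σ y') S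
    simpa [Prog.rename, Gate.rename, wireOf, hS, mapBank] using this
  | seq _ _ ih1 ih2 =>
    obtain ⟨S1, e1, h1, k1⟩ := ih1 S hS
    obtain ⟨S2, e2, h2, k2⟩ := ih2 S1 h1
    refine ⟨S2, ?_, h2, fun y hy => (k2 y hy).trans (k1 y hy)⟩
    rw [List.map_append]
    exact .seq e1 e2
  | branchEmpty hx _ ih =>
    obtain ⟨S1, e1, h1, k1⟩ := ih S hS
    exact ⟨S1, .branchEmpty ((hS _).trans hx) e1, h1, k1⟩
  | branchFalse hx _ ih =>
    obtain ⟨S1, e1, h1, k1⟩ := ih S hS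
    exact ⟨S1, .branchFalse ((hS _).trans hx) e1, h1, k1⟩
  | branchTrue hx _ ih =>
    obtain ⟨S1, e1, h1, k1⟩ := ih S hS
    exact ⟨S1, .branchTrue ((hS _).trans hx) e1, h1, k1⟩
  | loopDone hx => exact ⟨S, .loopDone ((hS _).trans hx), hS, fun _ _ => rfl⟩
  | loopStep hx _ _ ih1 ih2 =>
    obtain ⟨S1, e1, h1, k1⟩ := ih1 S hS
    obtain ⟨S2, e2, h2, k2⟩ := ih2 S1 h1
    refine ⟨S2, ?_, h2, fun y hy => (k2 y hy).trans (k1 y hy)⟩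
    rw [List.map_append]
    exact .loopStep (by rwa [hS]) e1 e2

/-! ## Layers of gates -/

/-- The concatenation `C (k - 1) ++ … ++ C 0`. -/
def countdown (C : ℕ → Circuit) : ℕ → Circuit
  | 0 => []
  | k + 1 => C k ++ countdown C k

theorem swapLayer_eq_countdown (b b' k : ℕ) :
    swapLayer b b' k = countdown (fun j => swapGates (b, 0, j) (b', 0, j)) k := by
  induction k with
  | zero => rfl
  | succ k ih => rw [swapLayer, countdown, ih]

/-- `p` writes the circuit `C k` if the stacks `3` and `4` have the heights `k` and `0`. -/
def WritesLayer (p : Prog) (C : ℕ → Circuit) (t : ℕ) : Prop :=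
  ∀ (S : Store) (k : ℕ), S 3 = List.replicate k true → S 4 = [] → Exec p S (C k) t S

/-- A round costs the test, the pop and the `t` steps of `p`; the last test adds 1. Since the pop
precedes `p`, the indices run from `k - 1` down to 0. -/
theorem WritesLayer.exec_loop {p : Prog} {C : ℕ → Circuit} {t : ℕ} (h : WritesLayer p C t)
    (k : ℕ) (S : Store) (h3 : S 3 = List.replicate k true) (h4 : S 4 = []) :
    Exec (.loop 3 (.seq (.pop 3) p)) S (countdown C k) (k * (t + 2) + 1)
      (Function.update S 3 []) := by
  induction k generalizing S with
  | zero =>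
    have : Function.update S 3 [] = S := by
      rw [Function.update_eq_self_iff, h3]
      rfl
    rw [this]
    simpa [countdown] using Exec.loopDone (p := .seq (.pop 3) p) h3
  | succ k ih =>
    have e1 := Exec.pop 3 S
    have h3' : Function.update S 3 (S 3).tail 3 = List.replicate k true := by
      simp [h3, List.replicate_succ]
    have h4' : Function.update S 3 (S 3).tail 4 = [] := by simp [h4]
    have e2 := h _ k h3' h4'
    have e3 := ih _ h3' h4'
    have := Exec.loopStep (x := 3) (by simp [h3]) (Exec.seq e1 e2) e3
    rw [Function.update_idem] at this
    rw [show (k + 1) * (t + 2) + 1 = 1 + t + (k * (t + 2) + 1) + 1 by ring]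
    exact this

/-- The program that exchanges two wires of two banks. -/
def swapProg (b b' : ℕ) : Prog :=
  .seq (.gate2 cnot b 4 3 b' 4 3) (.seq (.gate2 cnot b' 4 3 b 4 3) (.gate2 cnot b 4 3 b' 4 3))

theorem swapProg_writesLayer (b b' : ℕ) :
    WritesLayer (swapProg b b') (fun j => swapGates (b, 0, j) (b', 0, j)) 3 := by
  intro S k h3 h4
  have := Exec.seq (.gate2 cnot b 4 3 b' 4 3 S)
    (.seq (.gate2 cnot b' 4 3 b 4 3 S) (.gate2 cnot b 4 3 b' 4 3 S))
  simpa [wireOf, h3, h4, swapProg, swapGates] using this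

theorem initStore_eq (n m κ x : ℕ) :
    initStore n m κ x = List.replicate (initStore n m κ x).length true := by
  unfold initStore
  split <;> simp

theorem initStore_length_le (n m κ x : ℕ) : (initStore n m κ x).length ≤ n + m + κ := by
  unfold initStore
  split <;> simp <;> omega

/-- The algorithm that writes a layer of gates for every qubit of a register whose length is one of
the parameters. -/
def QPT.layer {𝒢 : GateSet} (x : ℕ) (p : Prog) (C : ℕ → Circuit) (t : ℕ) (hp : p.Uses 𝒢)
    (h : WritesLayer p C t) : QPT 𝒢 where
  prog := .seq (.copy x 3) (.loop 3 (.seq (.pop 3) p))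
  circuit n m κ := countdown C (initStore n m κ x).length
  uses := ⟨trivial, trivial, hp⟩
  polyTime := by
    refine ⟨Polynomial.C (t + 2) * Polynomial.X + Polynomial.C 2, fun n m κ => ⟨_, _,
      Exec.seq (.copy x 3 _) (h.exec_loop _ _ ?_ ?_), ?_⟩⟩
    · simpa using initStore_eq n m κ x
    · simp [initStore]
    · have := Nat.mul_le_mul_right (t + 2) (initStore_length_le n m κ x)
      simp only [Polynomial.eval_add, Polynomial.eval_mul, Polynomial.eval_C, Polynomial.eval_X]
      rw [mul_comm (t + 2)]
      omega

/-- The composition of two algorithms; the length of the register that is handed over is the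
parameter with the number `x`. -/
def QPT.comp {𝒢 : GateSet} (hC : cnot ∈ 𝒢.two) (x : ℕ) (P Q : QPT 𝒢) : QPT 𝒢 where
  -- Stack 3 counts the swaps and stack 4 stays empty to name the index 0. `P` works on the odd
  -- stacks from 5 on and `Q` on the even ones from 6 on, each with its own copy of the parameters.
  prog := .seq (.copy x 3) <| .seq (.copy 0 5) <| .seq (.copy 1 7) <| .seq (.copy 2 9) <|
    .seq (.copy 0 6) <| .seq (.copy 1 8) <| .seq (.copy 2 10) <|
    .seq (P.prog.rename (fun y => 2 * y + 5) bankFst) <|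
    .seq (.loop 3 (.seq (.pop 3) (swapProg 3 2))) (Q.prog.rename (fun y => 2 * y + 6) bankSnd)
  circuit n m κ :=
    compCircuit (initStore n m κ x).length (P.circuit n m κ) (Q.circuit n m κ)
  uses := ⟨trivial, trivial, trivial, trivial, trivial, trivial, trivial,
    Prog.uses_rename _ _ P.uses, ⟨trivial, hC, hC, hC⟩, Prog.uses_rename _ _ Q.uses⟩
  polyTime := by
    obtain ⟨p, hp⟩ := P.polyTime
    obtain ⟨q, hq⟩ := Q.polyTime
    -- Each swap costs 3 + 2 steps; the 8 counts seven copies and the final test of the loop.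
    refine ⟨p + q + Polynomial.C 5 * Polynomial.X + Polynomial.C 8, fun n m κ => ?_⟩
    obtain ⟨τ, s, e, hτ⟩ := hp n m κ
    obtain ⟨τ', s', e', hτ'⟩ := hq n m κ
    set S₀ := initStore n m κ with hS₀
    set S : Store := Function.update (Function.update (Function.update (Function.update
      (Function.update (Function.update (Function.update S₀ 3 (S₀ x)) 5 (S₀ 0)) 7 (S₀ 1)) 9 (S₀ 2))
      6 (S₀ 0)) 8 (S₀ 1)) 10 (S₀ 2) with hS
    have h0 : ∀ y, 3 ≤ y → S₀ y = [] := by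
      intro y hy
      obtain ⟨z, rfl⟩ := Nat.exists_eq_add_of_le' hy
      rfl
    have h5 : ∀ y, S (2 * y + 5) = S₀ y := by
      intro y
      match y with
      | 0 | 1 | 2 => simp [hS]
      | y + 3 =>
        rw [h0 (y + 3) (by omega)]
        simp only [hS, Function.update_apply]
        repeat rw [if_neg (by omega)]
        exact h0 _ (by omega)
    have h6 : ∀ y, S (2 * y + 6) = S₀ y := by
      intro y
      match y with
      | 0 | 1 | 2 => simp [hS]
      | y + 3 =>
        rw [h0 (y + 3) (by omega)]
        simp only [hS, Function.update_apply]
        repeat rw [if_neg (by omega)]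
        exact h0 _ (by omega)
    have h3 : S 3 = List.replicate (S₀ x).length true := by
      simpa [hS] using initStore_eq n m κ x
    have h4 : S 4 = [] := by simp [hS, h0]
    obtain ⟨S₁, e₁, -, k₁⟩ := e.rename (σ := fun y => 2 * y + 5) (fun a b h => by simpa using h)
      bankFst S h5
    have e₂ := (swapProg_writesLayer 3 2).exec_loop (S₀ x).length S₁
      ((k₁ 3 (by simp only [Set.mem_range, not_exists]; omega)).trans h3)
      ((k₁ 4 (by simp only [Set.mem_range, not_exists]; omega)).trans h4)
    obtain ⟨S₃, e₃, -, -⟩ := e'.rename (σ := fun y => 2 * y + 6) (fun a b h => by simpa using h)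
      bankSnd (Function.update S₁ 3 []) (fun y => by
        rw [Function.update_of_ne (by omega),
          k₁ _ (by simp only [Set.mem_range, not_exists]; omega), h6])
    have key := Exec.seq (.copy x 3 S₀) <| .seq (.copy 0 5 _) <| .seq (.copy 1 7 _) <|
      .seq (.copy 2 9 _) <| .seq (.copy 0 6 _) <| .seq (.copy 1 8 _) <| .seq (.copy 2 10 _) <|
      Exec.seq e₁ (.seq e₂ e₃)
    simp only [List.nil_append] at key
    rw [compCircuit, swapLayer_eq_countdown, List.append_assoc]
    refine ⟨_, _, key, ?_⟩
    have : (S₀ x).length ≤ n + m + κ := initStore_length_le n m κ x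
    simp only [Polynomial.eval_add, Polynomial.eval_mul, Polynomial.eval_C, Polynomial.eval_X]
    omega

/-! ## Maximally mixed registers -/

/-- A uniformly random bit on the wire `(1, 0, j)`, with a copy on the wire `(2, 0, j)`. -/
def coinGates (j : ℕ) : Circuit := [.one hadamard (1, 0, j), .two cnot (1, 0, j) (2, 0, j)]

/-- The program that writes `coinGates`. -/
def coinProg : Prog := .seq (.gate1 hadamard 1 4 3) (.gate2 cnot 1 4 3 2 4 3)

theorem coinProg_writesLayer : WritesLayer coinProg coinGates 2 := by
  intro S k h3 h4
  have := Exec.seq (.gate1 hadamard 1 4 3 S) (.gate2 cnot 1 4 3 2 4 3 S)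
  simpa [wireOf, h3, h4, coinProg, coinGates] using this

/-- The assignment `f`, with the bits `a` on the first wires of the banks `1` and `2`. -/
def setCoins {k : ℕ} (a : Fin k → Bool) (f : Wire → Bool) (w : Wire) : Bool :=
  if h : w.2.2 < k then if (w.1 = 1 ∨ w.1 = 2) ∧ w.2.1 = 0 then a ⟨w.2.2, h⟩ else f w else f w

theorem runCircuit_coinGates (j : ℕ) (f : Wire → Bool) (h1 : f (1, 0, j) = false)
    (h2 : f (2, 0, j) = false) :
    runCircuit (coinGates j) (Finsupp.single f 1) = ((Real.sqrt 2 : ℝ) : ℂ)⁻¹ •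
      ∑ b : Bool, Finsupp.single
        (Function.update (Function.update f (1, 0, j) b) (2, 0, j) b) 1 := by
  have hw : ((1, 0, j) : Wire) ≠ (2, 0, j) := by simp
  simp only [coinGates, runCircuit_cons, cnot_apply hw]
  simp [runCircuit, Gate.apply, hadamard, h1, Finsupp.mapDomain_add, Finsupp.mapDomain_single, h2,
    smul_add]

theorem runCircuit_coins (k : ℕ) (f : Wire → Bool)
    (hf : ∀ j < k, f (1, 0, j) = false ∧ f (2, 0, j) = false) :
    runCircuit (countdown coinGates k) (Finsupp.single f 1) =
      (((Real.sqrt 2 : ℝ) : ℂ)⁻¹ ^ k) •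
        ∑ a : Fin k → Bool, Finsupp.single (setCoins a f) 1 := by
  induction k generalizing f with
  | zero =>
    simp only [countdown, runCircuit, List.foldl_nil, pow_zero, one_smul,
      Fintype.sum_unique]
    congr 1
  | succ k ih =>
    rw [countdown, runCircuit_append, runCircuit_coinGates k f (hf k (by simp)).1 (hf k (by simp)).2,
      ← runLinear_apply, map_smul, map_sum, pow_succ', mul_smul]
    congr 1
    rw [← (Fin.snocEquiv fun _ : Fin (k + 1) => Bool).sum_comp, Fintype.sum_prod_type,
      Finset.smul_sum]
    refine Finset.sum_congr rfl fun b _ => ?_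
    rw [runLinear_apply, ih]
    · congr 1
      refine Finset.sum_congr rfl fun a _ => ?_
      congr 1
      funext ⟨c, i, j⟩
      rcases lt_trichotomy j k with h | h | h
      · have h' : j < k + 1 := by omega
        by_cases hc : (c = 1 ∨ c = 2) ∧ i = 0
        · simp [setCoins, Fin.snoc, h, h', hc]
        · simp [setCoins, h, h', hc, h.ne]
      · by_cases hc : (c = 1 ∨ c = 2) ∧ i = 0
        · rcases hc with ⟨rfl | rfl, rfl⟩ <;> simp [setCoins, Fin.snoc, h]
        · have h1 : ¬ (c = 1 ∧ i = 0) := fun h => hc ⟨.inl h.1, h.2⟩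
          have h2 : ¬ (c = 2 ∧ i = 0) := fun h => hc ⟨.inr h.1, h.2⟩
          simp [setCoins, h, hc, h1, h2]
      · have h1 : ¬ j < k := by omega
        have h2 : ¬ j < k + 1 := by omega
        simp [setCoins, h1, h2, h.ne']
    · intro j hj
      have := hf j (by omega)
      have hjk : j ≠ k := by omega
      simp [hjk, this]

/-- Bank 2 holds a copy of the random bits, so tracing it out kills every cross term between
different strings and leaves a uniform diagonal. -/
theorem outputState_coins (k : ℕ) :
    outputState (countdown coinGates k) k (1 : Op (Fin 0)) = maxMixed k := by
  classical
  suffices h : ∀ d : Fin 0 → Bool, reduced (fun j : Fin k => outWire j)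
      (runCircuit (countdown coinGates k) (load (fun j : Fin 0 => inWire 0 j) d))
      (runCircuit (countdown coinGates k) (load (fun j : Fin 0 => inWire 0 j) d)) = maxMixed k by
    rw [outputState, channel, Fintype.sum_unique, Fintype.sum_unique, Matrix.one_apply_eq, one_smul]
    exact h _
  intro d
  rw [load, runCircuit_coins, ← reducedₛₗ_apply]
  swap
  · intro j _
    constructor <;> · rw [Function.extend_apply' _ _ _ (by simp)]
  generalize Function.extend (fun j : Fin 0 => inWire 0 j) d (fun _ => false) = f
  ext x y
  simp only [LinearMap.map_smulₛₗ, map_smul, LinearMap.smul_apply, map_sum,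
    LinearMap.sum_apply, Matrix.smul_apply, Matrix.sum_apply, reducedₛₗ_apply, reduced_single]
  have key : ∀ a b : Fin k → Bool, ((setCoins a f) ∘ (fun j : Fin k => outWire j) = x ∧
      setCoins b f = Function.extend (fun j : Fin k => outWire j) y (setCoins a f)) ↔
      a = x ∧ b = x ∧ x = y := by
    intro a b
    have h1 : ∀ a : Fin k → Bool, (setCoins a f) ∘ (fun j : Fin k => outWire j) = a := by
      intro a
      funext j
      simp [setCoins, outWire]
    rw [h1]
    constructor
    · rintro ⟨rfl, h⟩
      have hb : b = y := by
        rw [← h1 b, h]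
        funext j
        simp [(outWire_injective k).extend_apply]
      have hb' : b = a := by
        funext j
        have := congrFun h (2, 0, j)
        rw [Function.extend_apply' _ _ _ (by simp [outWire])] at this
        simpa [setCoins] using this
      exact ⟨rfl, hb', hb'.symm.trans hb⟩
    · rintro ⟨rfl, rfl, rfl⟩
      refine ⟨rfl, funext fun w => ?_⟩
      by_cases hw : ∃ j : Fin k, outWire j = w
      · obtain ⟨j, rfl⟩ := hw
        rw [(outWire_injective k).extend_apply]
        exact congrFun (h1 b) j
      · rw [Function.extend_apply' _ _ _ hw]
  simp only [key, star_one, mul_one]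
  rw [Finset.sum_eq_single x, Finset.sum_eq_single x]
  · have hs : (((Real.sqrt 2 : ℝ) : ℂ)⁻¹) * (((Real.sqrt 2 : ℝ) : ℂ)⁻¹) = 2⁻¹ := by
      rw [← mul_inv, ← Complex.ofReal_mul, Real.mul_self_sqrt (by norm_num)]
      norm_num
    by_cases hxy : x = y
    · have := congrArg (· ^ k) hs
      simp only [mul_pow, inv_pow] at this
      simp [hxy, maxMixed, this]
    · simp [hxy, maxMixed]
  all_goals simp +contextual

/-! ## The identity with a part of the register dropped -/

theorem outputState_swapLayer (n m : ℕ) (ρ : Op (Fin (n + m))) :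
    outputState (swapLayer 0 1 n) n ρ = traceLast ρ := by
  classical
  ext a b
  simp only [outputState, channel, load, runCircuit_swapLayer (show 0 ≠ 1 by norm_num),
    Finsupp.mapDomain_single, Matrix.sum_apply, Matrix.smul_apply, reduced_single, traceLast,
    Matrix.of_apply]
  set inp := fun j : Fin (n + m) => inWire 0 j with hinp
  have hin : inp.Injective := inWire_injective _
  set out := fun j : Fin n => outWire j with hout
  -- After the swap the bits `a` sit on the output wires, while `c` stays in bank 0 and is traced
  -- out.
  set E : (Fin n → Bool) → (Fin m → Bool) → Wire → Bool :=
    fun a c => swapFun 0 1 n (Function.extend inp (Fin.append a c) fun _ => false) with hE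
  have h1 : ∀ a c, E a c ∘ out = a := by
    intro a c
    funext j
    have : ((0, 0, (j : ℕ)) : Wire) = inp (Fin.castAdd m j) := rfl
    simp only [hE, hout, swapFun, outWire, Function.comp_apply]
    simp [this, hin.extend_apply]
  have h2 : ∀ a c (j : Fin m), E a c (0, 0, n + j) = c j := by
    intro a c j
    have : ((0, 0, n + (j : ℕ)) : Wire) = inp (Fin.natAdd n j) := rfl
    simp only [hE, swapFun]
    simp [this, hin.extend_apply]
  have h3 : ∀ a c (b : Fin n → Bool), Function.extend out b (E a c) = E b c := by
    intro a c b
    funext w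
    by_cases hw : ∃ j, out j = w
    · obtain ⟨j, rfl⟩ := hw
      rw [(outWire_injective n).extend_apply]
      exact (congrFun (h1 b c) j).symm
    · rw [Function.extend_apply' _ _ _ hw]
      obtain ⟨d, i, j⟩ := w
      have hd : ¬ (d = 1 ∧ i = 0 ∧ j < n) := fun h =>
        hw ⟨⟨j, h.2.2⟩, by simp [hout, outWire, h.1, h.2.1]⟩
      simp only [hE, swapFun]
      by_cases hij : i = 0 ∧ j < n
      · have hd1 : d ≠ 1 := fun h => hd ⟨h, hij⟩
        have : ∀ a : Fin (n + m) → Bool,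
            Function.extend inp a (fun _ => false) (1, i, j) = false := by
          intro a
          rw [Function.extend_apply' _ _ _ (by simp [hinp, inWire])]
        by_cases hd0 : d = 0
        · simp [hij, hd0, this, show ((1, 0, j) : Wire) = (1, i, j) by rw [hij.1]]
        · have : ∀ a : Fin (n + m) → Bool,
              Function.extend inp a (fun _ => false) (d, i, j) = false := by
            intro a
            rw [Function.extend_apply' _ _ _ (by
              rintro ⟨t, ht⟩
              exact hd0 (by simpa [hinp, inWire] using (congrArg Prod.fst ht).symm))]
          simp only [hij, hd0, hd1, if_false, and_self, if_true]
          rw [hij.1] at this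
          rw [this, this]
      · rw [if_neg hij, if_neg hij]
        by_cases ht : ∃ t, inp t = (d, i, j)
        · obtain ⟨t, ht⟩ := ht
          rw [← ht, hin.extend_apply, hin.extend_apply]
          simp only [hinp, inWire, Prod.mk.injEq] at ht
          have htn : ¬ (t : ℕ) < n := fun h => hij ⟨ht.2.1.symm, ht.2.2 ▸ h⟩
          revert htn
          refine Fin.addCases (fun t => ?_) (fun t => ?_) t
          · intro h
            exact absurd t.2 h
          · intro _
            simp
        · rw [Function.extend_apply' _ _ _ ht, Function.extend_apply' _ _ _ ht]
  have key : ∀ a' c b' c', (E a' c ∘ out = a ∧ E b' c' = Function.extend out b (E a' c)) ↔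
      a' = a ∧ b' = b ∧ c' = c := by
    intro a' c b' c'
    rw [h1, h3]
    constructor
    · rintro ⟨rfl, h⟩
      refine ⟨rfl, ?_, ?_⟩
      · rw [← h1 b' c', h, h1]
      · funext j
        rw [← h2 b' c' j, h, h2]
    · rintro ⟨rfl, rfl, rfl⟩
      exact ⟨rfl, rfl⟩
  rw [← (Fin.appendEquiv n m).sum_comp, Fintype.sum_prod_type]
  simp only [← (Fin.appendEquiv (α := Bool) n m).sum_comp (fun x => ρ _ x • _)]
  have hA : ∀ p, Fin.appendEquiv (α := Bool) n m p = Fin.append p.1 p.2 := fun _ => rfl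
  simp only [Fintype.sum_prod_type, hA]
  simp only [hE] at key
  simp only [key, star_one, mul_one]
  rw [Finset.sum_eq_single a]
  · refine Finset.sum_congr rfl fun c _ => ?_
    rw [Finset.sum_eq_single b, Finset.sum_eq_single c]
    all_goals simp +contextual
  all_goals simp +contextual

/-! ## One copy of a state -/

theorem channel_copies_one (C : Circuit) {N : ℕ} {o : Type} (out : o → Wire) (ρ : Op (Fin N)) :
    channel C (fun q : Fin 1 × Fin N => inWire q.1 q.2) out (copies 1 ρ) =
      channel C (fun j : Fin N => inWire 0 j) out ρ := by
  classical
  set ε : (Fin N → Bool) ≃ (Fin 1 × Fin N → Bool) :=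
    (Equiv.uniqueProd (Fin N) (Fin 1)).symm.arrowCongr (Equiv.refl Bool) with hε
  have hε' : ∀ x i, ε x (0, i) = x i := fun x i => rfl
  have hl : ∀ x, load (fun q : Fin 1 × Fin N => inWire q.1 q.2) (ε x) =
      load (fun j : Fin N => inWire 0 j) x := by
    intro x
    simp only [load]
    congr 1
    funext w
    have hi : (fun q : Fin 1 × Fin N => inWire q.1 q.2).Injective := by
      rintro ⟨i, a⟩ ⟨i', b⟩ h
      simp only [inWire, Prod.mk.injEq] at h
      rw [Subsingleton.elim i i', Fin.ext h.2.2]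
    by_cases hw : ∃ j : Fin N, inWire 0 j = w
    · obtain ⟨j, rfl⟩ := hw
      rw [(inWire_injective N).extend_apply,
        show inWire 0 j = (fun q : Fin 1 × Fin N => inWire q.1 q.2) (0, j) from rfl,
        hi.extend_apply, hε']
    · rw [Function.extend_apply' _ _ _ hw, Function.extend_apply']
      rintro ⟨⟨i, j⟩, h⟩
      exact hw ⟨j, by simpa using h⟩
  unfold channel
  rw [← ε.sum_comp]
  refine Finset.sum_congr rfl fun x _ => ?_
  rw [← ε.sum_comp]
  refine Finset.sum_congr rfl fun y _ => ?_
  rw [hl, hl]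
  simp [copies, hε']

/-! ## The composition of algorithms -/

theorem outputState_comp {𝒢 : GateSet} (hC : cnot ∈ 𝒢.two) (x : ℕ) (P Q : QPT 𝒢) (n m κ : ℕ)
    {k N : ℕ} (hk : (initStore n m κ x).length = k) (o : ℕ) (ρ : Op (Fin N)) :
    outputState ((QPT.comp hC x P Q).circuit n m κ) o ρ =
      outputState (Q.circuit n m κ) o (outputState (P.circuit n m κ) k ρ) := by
  subst hk
  exact channel_compCircuit _ _ _ _ (inWire_injective N) (fun _ => rfl) _
    (outWire_injective o) (fun _ => rfl) ρ

theorem acceptProb_comp {𝒢 : GateSet} (hC : cnot ∈ 𝒢.two) (x : ℕ) (P Q : QPT 𝒢) (n m κ : ℕ)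
    {k N : ℕ} (hk : (initStore n m κ x).length = k) (ρ : Op (Fin N)) :
    acceptProb ((QPT.comp hC x P Q).circuit n m κ) (copies 1 ρ) =
      acceptProb (Q.circuit n m κ) (copies 1 (outputState (P.circuit n m κ) k ρ)) := by
  subst hk
  rw [acceptProb, acceptProb, channel_copies_one, channel_copies_one]
  exact congrArg (fun A : Op Unit => (A (fun _ => true) fun _ => true).re)
    (channel_compCircuit _ _ _ _ (inWire_injective N) (fun _ => rfl) _
      (fun _ _ _ => rfl) (fun _ => rfl) ρ)

/-- The algorithm that prepares a maximally mixed register; its length is the parameter `x`. -/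
def QPT.coins {𝒢 : GateSet} (hH : hadamard ∈ 𝒢.one) (hC : cnot ∈ 𝒢.two) (x : ℕ) : QPT 𝒢 :=
  QPT.layer x coinProg coinGates 2 ⟨hH, hC⟩ coinProg_writesLayer

theorem outputState_qptCoins {𝒢 : GateSet} (hH : hadamard ∈ 𝒢.one) (hC : cnot ∈ 𝒢.two) (x : ℕ)
    (n m κ : ℕ) {k : ℕ} (hk : (initStore n m κ x).length = k) :
    outputState ((QPT.coins hH hC x).circuit n m κ) k (1 : Op (Fin 0)) = maxMixed k := by
  subst hk
  exact outputState_coins _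

/-- The algorithm that hands on the first `n` qubits of its input. -/
def QPT.keepFirst {𝒢 : GateSet} (hC : cnot ∈ 𝒢.two) : QPT 𝒢 :=
  QPT.layer 0 (swapProg 0 1) _ 3 ⟨hC, hC, hC⟩ (swapProg_writesLayer 0 1)

theorem outputState_keepFirst {𝒢 : GateSet} (hC : cnot ∈ 𝒢.two) (n m κ l : ℕ)
    (ρ : Op (Fin (n + l))) :
    outputState ((QPT.keepFirst hC).circuit n m κ) n ρ = traceLast ρ := by
  rw [← outputState_swapLayer, swapLayer_eq_countdown]
  simp [QPT.keepFirst, QPT.layer, initStore]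

/-- A circuit that prepares `n + m` qubits prepares the partial trace on the first `n` qubits. -/
theorem outputState_traceLast (C : Circuit) {k : ℕ} (n m : ℕ) (ρ : Op (Fin k)) :
    outputState C n ρ = traceLast (outputState C (n + m) ρ) := by
  classical
  have key : ∀ v u : Vec, reduced (fun j : Fin n => outWire j) v u =
      traceLast (reduced (fun j : Fin (n + m) => outWire j) v u) := by
    intro v u
    ext a b
    simp only [reduced, traceLast, Matrix.of_apply]
    unfold Finsupp.sum
    rw [Finset.sum_comm]
    refine Finset.sum_congr rfl fun f _ => ?_
    beta_reduce
    by_cases hf : f ∘ (fun j : Fin n => outWire j) = a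
    -- The last `m` bits are dictated by the basis state `f`, so only one term of the partial trace
    -- survives.
    · rw [if_pos hf, Finset.sum_eq_single (fun j : Fin m => f (outWire (n + j)))]
      · have h1 : f ∘ (fun j : Fin (n + m) => outWire j) =
            Fin.append a fun j : Fin m => f (outWire (n + j)) := by
          subst hf
          funext t
          refine Fin.addCases (fun t => ?_) (fun t => ?_) t <;> simp
        rw [if_pos h1]
        congr 3
        funext w
        by_cases hw : ∃ j : Fin (n + m), outWire j = w
        · obtain ⟨t, rfl⟩ := hw
          rw [(outWire_injective (n + m)).extend_apply]
          refine Fin.addCases (fun t => ?_) (fun t => ?_) t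
          · rw [Fin.append_left]
            exact (outWire_injective n).extend_apply _ _ t
          · rw [Fin.append_right, Function.extend_apply']
            · simp
            · rintro ⟨j, hj⟩
              simp only [outWire, Prod.mk.injEq, Fin.val_natAdd] at hj
              omega
        · rw [Function.extend_apply' _ _ _ hw, Function.extend_apply']
          rintro ⟨j, hj⟩
          exact hw ⟨Fin.castAdd m j, hj⟩
      · intro c _ hc
        rw [if_neg]
        intro h
        refine hc (funext fun j => ?_)
        have := congrFun h (Fin.natAdd n j)
        simpa using this.symm
      · simp
    · rw [if_neg hf, Finset.sum_eq_zero]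
      intro c _
      rw [if_neg]
      intro h
      refine hf (funext fun j => ?_)
      have := congrFun h (Fin.castAdd m j)
      simpa using this
  ext a b
  simp only [outputState, channel, key]
  simp only [traceLast, Matrix.of_apply, Matrix.sum_apply, Matrix.smul_apply, Finset.smul_sum]
  calc _ = ∑ x, ∑ c, ∑ y, _ := Finset.sum_congr rfl fun x _ => Finset.sum_comm
    _ = _ := Finset.sum_comm

/-! ## Acceptance probabilities are linear -/

/-- On a single copy the acceptance probability is linear in the state, so averages over keys or
over the Haar measure pass to the state. -/
theorem exists_acceptProb_eq (C : Circuit) (N : ℕ) :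
    ∃ c : (Fin N → Bool) → (Fin N → Bool) → ℂ, ∀ ρ : Op (Fin N),
      acceptProb C (copies 1 ρ) = (∑ x, ∑ y, ρ x y * c x y).re := by
  refine ⟨fun x y => reduced (fun _ : Unit => outWire 0)
    (runCircuit C (load (fun j : Fin N => inWire 0 j) x))
    (runCircuit C (load (fun j : Fin N => inWire 0 j) y)) (fun _ => true) (fun _ => true),
    fun ρ => ?_⟩
  rw [acceptProb, channel_copies_one]
  simp [channel, Matrix.sum_apply]

theorem keyAverage_apply {κ : ℕ} {ι : Type} (ρ : (Fin κ → Bool) → Op ι) (x y : ι → Bool) :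
    keyAverage ρ x y = ((2 : ℂ) ^ κ)⁻¹ * ∑ k, ρ k x y := by
  simp [keyAverage, Matrix.smul_apply, Matrix.sum_apply, Complex.real_smul]

theorem acceptProb_keyAverage (C : Circuit) {κ N : ℕ} (ρ : (Fin κ → Bool) → Op (Fin N)) :
    keyAverage (fun k => acceptProb C (copies 1 (ρ k))) =
      acceptProb C (copies 1 (keyAverage ρ)) := by
  obtain ⟨c, hc⟩ := exists_acceptProb_eq C N
  have h2 : ((2 : ℂ) ^ κ)⁻¹ = (((2 : ℝ) ^ κ)⁻¹ : ℝ) := by push_cast; rfl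
  have : ∑ x, ∑ y, (keyAverage ρ) x y * c x y =
      (((2 : ℝ) ^ κ)⁻¹ : ℝ) * ∑ k, ∑ x, ∑ y, ρ k x y * c x y := by
    simp only [keyAverage_apply, h2, Finset.sum_mul, Finset.mul_sum, mul_assoc]
    calc _ = ∑ x, ∑ k, ∑ y, _ := Finset.sum_congr rfl fun x _ => Finset.sum_comm
      _ = _ := Finset.sum_comm
  simp only [hc]
  rw [this, Complex.re_ofReal_mul, Complex.re_sum]
  rfl

/-! ## The first moment of the Haar measure -/

section Haar

variable {ι : Type} [Fintype ι] [DecidableEq ι]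

instance haarUnitary_isMulLeftInvariant : (haarUnitary ι).IsMulLeftInvariant :=
  inferInstanceAs (Measure.haarMeasure ⊤).IsMulLeftInvariant

/-- The unitary matrix of a permutation of the basis. -/
def permUnitary (σ : Equiv.Perm ι) : Matrix.unitaryGroup ι ℂ :=
  ⟨(1 : Matrix ι ι ℂ).submatrix σ id, by
    rw [Matrix.mem_unitaryGroup_iff]
    ext a b
    simp [Matrix.mul_apply, Matrix.one_apply, apply_ite, eq_comm]⟩

/-- The diagonal unitary matrix that changes one sign. -/
def signUnitary (x : ι) : Matrix.unitaryGroup ι ℂ :=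
  ⟨Matrix.diagonal fun i => if i = x then -1 else 1, by
    rw [Matrix.mem_unitaryGroup_iff, Matrix.star_eq_conjTranspose, Matrix.diagonal_conjTranspose,
      Matrix.diagonal_mul_diagonal, ← Matrix.diagonal_one]
    congr 1
    funext i
    by_cases h : i = x <;> simp [h]⟩

theorem continuous_unitary_entry (x y : ι) :
    Continuous fun U : Matrix.unitaryGroup ι ℂ => U.1 x y :=
  (continuous_apply y).comp ((continuous_apply x).comp continuous_subtype_val)

theorem integrable_haarUnitary {f : Matrix.unitaryGroup ι ℂ → ℂ} (hf : Continuous f) :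
    Integrable f (haarUnitary ι) := by
  exact hf.integrable_of_hasCompactSupport (HasCompactSupport.of_compactSpace _)

/-- Flipping the sign of row `x` preserves the Haar measure and negates the integrand. -/
theorem integral_haarUnitary_offDiag {x y : ι} (hxy : x ≠ y) (z : ι) :
    ∫ U : Matrix.unitaryGroup ι ℂ, U.1 x z * star (U.1 y z) ∂haarUnitary ι = 0 := by
  have h := integral_mul_left_eq_self (μ := haarUnitary ι)
    (fun U : Matrix.unitaryGroup ι ℂ => U.1 x z * star (U.1 y z)) (signUnitary x)
  have h1 : ∀ U : Matrix.unitaryGroup ι ℂ,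
      (signUnitary x * U).1 x z * star ((signUnitary x * U).1 y z) =
        -(U.1 x z * star (U.1 y z)) := by
    intro U
    simp [signUnitary, Matrix.diagonal_mul, hxy.symm]
  simp only [h1, integral_neg] at h
  exact self_eq_neg.1 h.symm

/-- Swapping rows shows that the integral does not depend on `x`; the sum over all rows is 1 because
columns of a unitary are normalized. -/
theorem integral_haarUnitary_diag (x z : ι) :
    ∫ U : Matrix.unitaryGroup ι ℂ, U.1 x z * star (U.1 x z) ∂haarUnitary ι =
      (Fintype.card ι : ℂ)⁻¹ := by
  have h : ∀ y, ∫ U : Matrix.unitaryGroup ι ℂ, U.1 y z * star (U.1 y z) ∂haarUnitary ι =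
      ∫ U : Matrix.unitaryGroup ι ℂ, U.1 x z * star (U.1 x z) ∂haarUnitary ι := by
    intro y
    have h := integral_mul_left_eq_self (μ := haarUnitary ι)
      (fun U : Matrix.unitaryGroup ι ℂ => U.1 y z * star (U.1 y z)) (permUnitary (Equiv.swap x y))
    have h1 : ∀ U : Matrix.unitaryGroup ι ℂ, (permUnitary (Equiv.swap x y) * U).1 y z = U.1 x z := by
      intro U
      simp [permUnitary, Matrix.mul_apply, Matrix.one_apply]
    simp only [h1] at h
    exact h.symm
  have hs : ∑ y, ∫ U : Matrix.unitaryGroup ι ℂ, U.1 y z * star (U.1 y z) ∂haarUnitary ι = 1 := by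
    rw [← integral_finsetSum]
    · have : ∀ U : Matrix.unitaryGroup ι ℂ, ∑ y, U.1 y z * star (U.1 y z) = 1 := by
        intro U
        have := congrFun (congrFun (Matrix.mem_unitaryGroup_iff'.1 U.2) z) z
        rw [Matrix.mul_apply] at this
        simpa [Matrix.star_apply, mul_comm] using this
      simp only [this]
      simp
    · intro y _
      exact integrable_haarUnitary
        ((continuous_unitary_entry y z).mul (continuous_unitary_entry y z).star)
  rw [Finset.sum_congr rfl fun y _ => h y, Finset.sum_const, Finset.card_univ, nsmul_eq_mul] at hs
  exact eq_inv_of_mul_eq_one_right hs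

end Haar

theorem integral_acceptProb_haarState (C : Circuit) (N : ℕ) :
    ∫ φ, acceptProb C (copies 1 (pureState φ)) ∂haarState N =
      acceptProb C (copies 1 (maxMixed N)) := by
  obtain ⟨c, hc⟩ := exists_acceptProb_eq C N
  simp only [hc, pureState, Matrix.of_apply]
  have hcont : Continuous fun φ : (Fin N → Bool) → ℂ =>
      ∑ x, ∑ y, φ x * star (φ y) * c x y := by fun_prop
  have hU : Continuous fun U : Matrix.unitaryGroup (Fin N → Bool) ℂ => fun x =>
      U.1 x fun _ => false := continuous_pi fun x => continuous_unitary_entry x _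
  refine (integral_map hU.aemeasurable
    (Complex.continuous_re.comp hcont).aestronglyMeasurable).trans ?_
  have h1 := Complex.reCLM.integral_comp_comm (integrable_haarUnitary (hcont.comp hU))
  refine h1.trans (congrArg Complex.re ?_)
  simp only [Function.comp_apply]
  have hint : ∀ x y, Integrable (fun U : Matrix.unitaryGroup (Fin N → Bool) ℂ =>
      U.1 x (fun _ => false) * star (U.1 y fun _ => false) * c x y) (haarUnitary _) :=
    fun x y => integrable_haarUnitary (((continuous_unitary_entry x _).mul
      (continuous_unitary_entry y _).star).mul continuous_const)
  rw [integral_finsetSum _ fun x _ => integrable_finsetSum _ fun y _ => hint x y]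
  refine Finset.sum_congr rfl fun x _ => ?_
  rw [integral_finsetSum _ fun y _ => hint x y]
  refine Finset.sum_congr rfl fun y _ => ?_
  rw [integral_mul_const]
  congr 1
  by_cases hxy : x = y
  · subst hxy
    rw [integral_haarUnitary_diag]
    simp [maxMixed]
  · rw [integral_haarUnitary_offDiag hxy]
    simp [maxMixed, hxy]

/-! ## Lower bounds on the trace norm -/

section TraceNorm

variable {ι : Type} [Fintype ι] [DecidableEq ι]

theorem inner_toEuclideanLin (A : Matrix ι ι ℂ) (v w : EuclideanSpace ℂ ι) :
    inner ℂ v (Matrix.toEuclideanLin A w) = ∑ a, ∑ b, star (v a) * A a b * w b := by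
  simp only [PiLp.inner_apply, RCLike.inner_apply, Matrix.toLpLin_apply, Matrix.mulVec,
    dotProduct, Finset.sum_mul]
  refine Finset.sum_congr rfl fun a _ => Finset.sum_congr rfl fun b _ => ?_
  simp only [RCLike.star_def]
  ring

/-- The eigenvectors of A†A are the right singular vectors of A. -/
theorem norm_toEuclideanLin_eigenvectorBasis (A : Matrix ι ι ℂ) (i : ι) :
    ‖Matrix.toEuclideanLin A
        ((Matrix.isHermitian_conjTranspose_mul_self A).eigenvectorBasis i)‖ =
      Real.sqrt ((Matrix.isHermitian_conjTranspose_mul_self A).eigenvalues i) := by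
  set hA := Matrix.isHermitian_conjTranspose_mul_self A
  set v := hA.eigenvectorBasis i with hv
  have h1 : Matrix.toEuclideanLin A.conjTranspose (Matrix.toEuclideanLin A v) = (hA.eigenvalues i : ℂ) • v := by
    have := hA.mulVec_eigenvectorBasis i
    rw [← Matrix.mulVec_mulVec] at this
    ext a
    simpa [Matrix.toLpLin_apply] using congrFun this a
  have h2 : inner ℂ (Matrix.toEuclideanLin A v) (Matrix.toEuclideanLin A v) =
      (hA.eigenvalues i : ℂ) := by
    rw [← LinearMap.adjoint_inner_right, ← Matrix.toEuclideanLin_conjTranspose_eq_adjoint, h1,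
      inner_smul_right, inner_self_eq_norm_sq_to_K, hv, hA.eigenvectorBasis.norm_eq_one]
    simp
  rw [inner_self_eq_norm_sq_to_K] at h2
  have h3 : ‖Matrix.toEuclideanLin A v‖ ^ 2 = hA.eigenvalues i :=
    Complex.ofReal_injective (by push_cast; exact h2)
  rw [← h3, Real.sqrt_sq (norm_nonneg _)]

/-- The sum is the real part of the trace of A compressed to the span of `w`. Expand in right
singular vectors v_i; for each i, Cauchy–Schwarz over j and Bessel's inequality for v_i and A v_i
bound the contribution by ‖A v_i‖, the singular value. -/
theorem sum_inner_le_traceNorm (A : Matrix ι ι ℂ) {r : ℕ} {w : Fin r → EuclideanSpace ℂ ι}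
    (hw : Orthonormal ℂ w) :
    ∑ j, (inner ℂ (w j) (Matrix.toEuclideanLin A (w j))).re ≤ traceNorm A := by
  set v := (Matrix.isHermitian_conjTranspose_mul_self A).eigenvectorBasis
  set T := Matrix.toEuclideanLin A
  have h1 : ∀ j, (inner ℂ (w j) (T (w j))).re ≤
      ∑ i, ‖inner ℂ (w j) (v i)‖ * ‖inner ℂ (w j) (T (v i))‖ := by
    intro j
    refine (Complex.re_le_norm _).trans ?_
    have h : inner ℂ (w j) (T (w j)) =
        ∑ i, inner ℂ (v i) (w j) * inner ℂ (w j) (T (v i)) := by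
      -- Both occurrences of `w j` are expanded; the first is folded back once `T` has entered the
      -- sum in the second.
      conv_lhs => rw [← v.sum_repr' (w j), map_sum, v.sum_repr' (w j), inner_sum]
      simp only [map_smul, inner_smul_right]
    rw [h]
    refine (norm_sum_le _ _).trans (le_of_eq ?_)
    simp only [norm_mul, norm_inner_symm (v _)]
  refine (Finset.sum_le_sum fun j _ => h1 j).trans ?_
  rw [Finset.sum_comm, traceNorm]
  refine Finset.sum_le_sum fun i _ => ?_
  refine (Real.sum_mul_le_sqrt_mul_sqrt _ _ _).trans ?_
  rw [← norm_toEuclideanLin_eigenvectorBasis]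
  have h2 := hw.sum_inner_products_le (s := Finset.univ) (v i)
  have h3 := hw.sum_inner_products_le (s := Finset.univ) (T (v i))
  rw [v.norm_eq_one] at h2
  have h4 : √(∑ j, ‖inner ℂ (w j) (v i)‖ ^ 2) ≤ 1 := Real.sqrt_le_one.2 (by simpa using h2)
  have h5 : √(∑ j, ‖inner ℂ (w j) (T (v i))‖ ^ 2) ≤ ‖T (v i)‖ :=
    (Real.sqrt_le_left (norm_nonneg _)).2 h3
  calc _ ≤ 1 * ‖T (v i)‖ := mul_le_mul h4 h5 (Real.sqrt_nonneg _) zero_le_one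
    _ = _ := one_mul _

theorem traceNorm_nonneg (A : Matrix ι ι ℂ) : 0 ≤ traceNorm A :=
  Finset.sum_nonneg fun _ _ => Real.sqrt_nonneg _

/-- A mixture of ensembles of rank at most `card Λ` is far from the maximally mixed state if few of
them carry much weight. -/
theorem sum_weight_le_traceNorm {Λ : Type} [Fintype Λ] {r : ℕ} {p : Fin r → ℝ}
    (hp : ∀ i, 0 ≤ p i) {χ : Fin r → Λ → EuclideanSpace ℂ ι} (hχ : ∀ i, ∑ l, ‖χ i l‖ ^ 2 = 1)
    {d : ℝ} {A : Matrix ι ι ℂ}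
    (hA : ∀ a b, A a b = ∑ i, p i * ∑ l, χ i l a * star (χ i l b) -
      (d : ℂ)⁻¹ * (1 : Matrix ι ι ℂ) a b) (hd : 0 < d) (S : Finset (Fin r)) :
    ∑ i ∈ S, p i ≤ (S.card * Fintype.card Λ : ℕ) / d + traceNorm A := by
  classical
  -- The test subspace holds every vector of the ensembles in `S`. The maximally mixed part gives it
  -- weight `finrank W / d`.
  set W : Submodule ℂ (EuclideanSpace ℂ ι) :=
    Submodule.span ℂ (Set.range fun q : S × Λ => χ q.1 q.2) with hW
  have hrank : Module.finrank ℂ W ≤ S.card * Fintype.card Λ := by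
    refine (finrank_range_le_card _).trans ?_
    simp
  set B := stdOrthonormalBasis ℂ W
  set w : Fin (Module.finrank ℂ W) → EuclideanSpace ℂ ι := fun j => (B j : EuclideanSpace ℂ ι)
  have hw : Orthonormal ℂ w := B.orthonormal.comp_linearIsometry W.subtypeₗᵢ
  have hq : ∀ u : EuclideanSpace ℂ ι, (inner ℂ u (Matrix.toEuclideanLin A u)).re =
      ∑ i, p i * ∑ l, ‖inner ℂ u (χ i l)‖ ^ 2 - d⁻¹ * ‖u‖ ^ 2 := by
    intro u
    have h1 : ∀ i l, ((‖inner ℂ u (χ i l)‖ ^ 2 : ℝ) : ℂ) =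
        ∑ a, ∑ b, star (u a) * (χ i l a * star (χ i l b)) * u b := by
      intro i l
      rw [Complex.ofReal_pow, ← Complex.mul_conj', inner_conj_symm]
      simp only [PiLp.inner_apply, RCLike.inner_apply, Finset.sum_mul_sum, RCLike.star_def]
      refine Finset.sum_congr rfl fun a _ => Finset.sum_congr rfl fun b _ => ?_
      ring
    have h2 : ((‖u‖ ^ 2 : ℝ) : ℂ) = ∑ a, star (u a) * u a := by
      have := inner_self_eq_norm_sq_to_K (𝕜 := ℂ) u
      simp only [PiLp.inner_apply, RCLike.inner_apply, mul_comm (u _)] at this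
      simpa using this.symm
    have : inner ℂ u (Matrix.toEuclideanLin A u) =
        ((∑ i, p i * ∑ l, ‖inner ℂ u (χ i l)‖ ^ 2 - d⁻¹ * ‖u‖ ^ 2 : ℝ) : ℂ) := by
      rw [inner_toEuclideanLin]
      simp only [Complex.ofReal_sub, Complex.ofReal_sum, Complex.ofReal_mul, h1, h2, hA,
        Complex.ofReal_inv, mul_sub, sub_mul, Finset.sum_sub_distrib]
      congr 1
      · simp only [Finset.mul_sum, Finset.sum_mul]
        calc _ = ∑ a, ∑ i, ∑ b, ∑ l, _ := Finset.sum_congr rfl fun a _ => Finset.sum_comm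
          _ = ∑ i, ∑ a, ∑ b, ∑ l, _ := Finset.sum_comm
          _ = ∑ i, ∑ a, ∑ l, ∑ b, _ := Finset.sum_congr rfl fun i _ => Finset.sum_congr rfl
              fun a _ => Finset.sum_comm
          _ = ∑ i, ∑ l, ∑ a, ∑ b, _ := Finset.sum_congr rfl fun i _ => Finset.sum_comm
          _ = _ := Finset.sum_congr rfl fun i _ => Finset.sum_congr rfl fun l _ =>
              Finset.sum_congr rfl fun a _ => Finset.sum_congr rfl fun b _ => by ring
      · simp [Matrix.one_apply, Finset.mul_sum, mul_left_comm, mul_assoc]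
    rw [this, Complex.ofReal_re]
  have hmem : ∀ i ∈ S, ∀ l, ∑ j, ‖inner ℂ (w j) (χ i l)‖ ^ 2 = ‖χ i l‖ ^ 2 := by
    intro i hi l
    exact B.sum_sq_norm_inner_right ⟨χ i l, Submodule.subset_span ⟨(⟨i, hi⟩, l), rfl⟩⟩
  have main := sum_inner_le_traceNorm A hw
  simp only [hq, hw.1, one_pow, mul_one, Finset.sum_sub_distrib, Finset.sum_const,
    Finset.card_univ, Fintype.card_fin, nsmul_eq_mul] at main
  -- Ensembles in `S` lie in `W` and pass the test with certainty by Parseval; the others contribute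
  -- a nonnegative amount.
  have h1 : ∑ i ∈ S, p i ≤ ∑ j, ∑ i, p i * ∑ l, ‖inner ℂ (w j) (χ i l)‖ ^ 2 := by
    rw [Finset.sum_comm]
    calc ∑ i ∈ S, p i = ∑ i ∈ S, ∑ j, p i * ∑ l, ‖inner ℂ (w j) (χ i l)‖ ^ 2 := by
          refine Finset.sum_congr rfl fun i hi => ?_
          rw [← Finset.mul_sum, Finset.sum_comm, Finset.sum_congr rfl fun l _ => hmem i hi l, hχ,
            mul_one]
      _ ≤ _ := Finset.sum_le_sum_of_subset_of_nonneg (Finset.subset_univ _) fun i _ _ =>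
          Finset.sum_nonneg fun j _ => mul_nonneg (hp i) (by positivity)
  have h2 : (Module.finrank ℂ W : ℝ) * d⁻¹ ≤ (S.card * Fintype.card Λ : ℕ) / d := by
    rw [div_eq_mul_inv]
    gcongr
  linarith

end TraceNorm

/-! ## Entropy and the layers of a distribution -/

/-- Fewer than 2^((j+1)/2) indices can have weight above 2^(-(j+1)/2), so by `hT` they carry at most
2^((j+1)/2 − N) + T. The rest of the mass has surprisal at least (j+1)/2. Summing half of it over j
< 2N gives H ≥ N − 1/(2(1−q)) − N·T with q = 2^(-1/2). -/
theorem entropy_layer_bound {r : ℕ} {p : Fin r → ℝ} (hp : ∀ i, 0 ≤ p i) (hs : ∑ i, p i = 1)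
    {T : ℝ} {N : ℕ}
    (hT : ∀ S : Finset (Fin r), ∑ i ∈ S, p i ≤ S.card / 2 ^ N + T)
    (hH : -∑ i, p i * Real.logb 2 (p i) ≤ N - 2) : 1 / 4 ≤ N * T := by
  -- Thresholds in half bits are essential: with whole bits the geometric series tends to 2 and uses
  -- up the slack in `N - 2`, leaving only an exponentially small bound.
  set q : ℝ := √(1 / 2) with hq
  have hq0 : 0 < q := Real.sqrt_pos.2 (by norm_num)
  have hqq : q ^ 2 = 1 / 2 := Real.sq_sqrt (by norm_num)
  have hq1 : q ≤ 0.7072 := by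
    rw [hq, Real.sqrt_le_left (by norm_num)]
    norm_num
  have hlog : Real.logb 2 q = -(1 / 2) := by
    rw [hq, Real.sqrt_eq_rpow, Real.logb_rpow_eq_mul_logb_of_pos (by norm_num), one_div,
      Real.logb_inv, Real.logb_self_eq_one (by norm_num)]
    norm_num
  -- the weight above the threshold `q ^ (j + 1)`
  have hlayer : ∀ j : ℕ, ∑ i with q ^ (j + 1) < p i, p i ≤ q ^ (2 * N) * (q ^ (j + 1))⁻¹ + T := by
    intro j
    set S := Finset.univ.filter fun i => q ^ (j + 1) < p i with hS
    have hc : (S.card : ℝ) * q ^ (j + 1) ≤ 1 := by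
      rw [← nsmul_eq_mul, ← hs]
      refine (Finset.card_nsmul_le_sum S p _ fun i hi => ?_).trans
        (Finset.sum_le_sum_of_subset_of_nonneg (Finset.subset_univ _) fun i _ _ => hp i)
      exact (Finset.mem_filter.1 hi).2.le
    have hc' : (S.card : ℝ) ≤ (q ^ (j + 1))⁻¹ := by
      rw [← one_div, le_div_iff₀ (by positivity)]
      exact hc
    refine (hT S).trans (add_le_add_left ?_ T)
    rw [pow_mul, hqq, div_eq_mul_inv, mul_comm, one_div, inv_pow]
    gcongr
  -- every weight is counted once per half bit of its surprisal
  have hpoint : ∀ i, (1 / 2 : ℝ) * ∑ j ∈ Finset.range (2 * N),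
      (if q ^ (j + 1) < p i then 0 else p i) ≤ -(p i * Real.logb 2 (p i)) := by
    intro i
    rcases (hp i).eq_or_lt with h0 | h0
    · simp [← h0]
    have hpi : p i ≤ 1 := hs ▸ Finset.single_le_sum (fun i _ => hp i) (Finset.mem_univ i)
    set X := -Real.logb 2 (p i) with hX
    have hX0 : 0 ≤ X := by
      have := Real.logb_nonpos (b := 2) (by norm_num) h0.le hpi
      linarith
    have hcard : (((Finset.range (2 * N)).filter fun j => ¬ q ^ (j + 1) < p i).card : ℝ) ≤
        2 * X := by
      refine le_trans ?_ (Nat.floor_le (by linarith : 0 ≤ 2 * X))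
      rw [Nat.cast_le, ← Finset.card_range ⌊2 * X⌋₊]
      refine Finset.card_le_card fun j hj => ?_
      have hj' : p i ≤ q ^ (j + 1) := not_lt.1 (Finset.mem_filter.1 hj).2
      have := Real.logb_le_logb_of_le (b := 2) (by norm_num) h0 hj'
      rw [Real.logb_pow, hlog] at this
      rw [Finset.mem_range]
      refine Nat.lt_of_succ_le (Nat.le_floor ?_)
      push_cast at this ⊢
      linarith
    have : ∑ j ∈ Finset.range (2 * N), (if q ^ (j + 1) < p i then 0 else p i) =
        ((Finset.range (2 * N)).filter fun j => ¬ q ^ (j + 1) < p i).card * p i := by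
      rw [← nsmul_eq_mul, ← Finset.sum_const, Finset.sum_filter]
      refine Finset.sum_congr rfl fun j _ => ?_
      split_ifs <;> rfl
    rw [this]
    have := mul_le_mul_of_nonneg_right hcard h0.le
    linarith
  have hsum : ∀ j : ℕ, ∑ i, (if q ^ (j + 1) < p i then 0 else p i) =
      1 - ∑ i with q ^ (j + 1) < p i, p i := by
    intro j
    rw [← hs, Finset.sum_filter, ← Finset.sum_sub_distrib]
    refine Finset.sum_congr rfl fun i _ => ?_
    split_ifs <;> simp
  have hgeom : ∑ j ∈ Finset.range (2 * N), q ^ (2 * N) * (q ^ (j + 1))⁻¹ ≤ 1 / (1 - q) := by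
    have h1 : ∀ j ∈ Finset.range (2 * N), q ^ (2 * N) * (q ^ (j + 1))⁻¹ = q ^ (2 * N - 1 - j) := by
      intro j hj
      have := Finset.mem_range.1 hj
      rw [← div_eq_mul_inv, div_eq_iff (by positivity), ← pow_add]
      congr 1
      omega
    rw [Finset.sum_congr rfl h1, Finset.sum_range_reflect (fun j => q ^ j),
      le_div_iff₀ (by linarith), geom_sum_mul_neg]
    have : 0 ≤ q ^ (2 * N) := by positivity
    linarith
  have htotal : (1 / 2 : ℝ) * ∑ j ∈ Finset.range (2 * N),
      (1 - (q ^ (2 * N) * (q ^ (j + 1))⁻¹ + T)) ≤ N - 2 := by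
    refine le_trans ?_ hH
    rw [← Finset.sum_neg_distrib]
    refine le_trans ?_ (Finset.sum_le_sum fun i _ => hpoint i)
    rw [← Finset.mul_sum, Finset.sum_comm]
    gcongr with j _
    rw [hsum]
    linarith [hlayer j]
  simp only [Finset.sum_sub_distrib, Finset.sum_add_distrib, Finset.sum_const, Finset.card_range,
    nsmul_eq_mul, mul_one, Nat.cast_mul, Nat.cast_ofNat] at htotal
  -- Half of 3.42 is 1.71, so N·T ≥ 2 − 1.71 > 1/4.
  have h3 : 1 / (1 - q) ≤ 3.42 := by
    rw [div_le_iff₀ (by linarith)]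
    linarith
  nlinarith [hgeom, htotal, h3]

/-! ## Partial traces and averages -/

theorem traceLast_maxMixed (n m : ℕ) : traceLast (maxMixed (n + m)) = maxMixed n := by
  ext a b
  have : ∀ c : Fin m → Bool, Fin.append a c = Fin.append b c ↔ a = b := by
    intro c
    refine ⟨fun h => funext fun i => ?_, fun h => h ▸ rfl⟩
    simpa using congrFun h (Fin.castAdd m i)
  by_cases hab : a = b
  · simp [traceLast, maxMixed, hab, pow_add]
  · simp [traceLast, maxMixed, hab, Matrix.one_apply, this]

theorem traceLast_keyAverage {κ n m : ℕ} (ρ : (Fin κ → Bool) → Op (Fin (n + m))) :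
    traceLast (keyAverage ρ) = keyAverage fun k => traceLast (ρ k) := by
  ext a b
  simp only [keyAverage_apply, traceLast, Matrix.of_apply, ← Finset.mul_sum]
  rw [Finset.sum_comm]

/-- A maximally mixed key register is the uniform mixture of the keys, so it replaces the sampling
of a key. -/
theorem outputState_maxMixed (C : Circuit) (n κ : ℕ) :
    outputState C n (maxMixed κ) =
      keyAverage fun k : Fin κ → Bool => outputState C n (basisState k) := by
  ext a b
  simp [keyAverage_apply, outputState, channel, maxMixed, basisState, Matrix.one_apply,
    Matrix.single_apply, Matrix.sum_apply, ite_and, Finset.mul_sum]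

/-! ## Mixed unitary channels -/

theorem map_maxMixed {n : ℕ} (Φ : MixedUnitary n) : Φ.map (maxMixed n) = maxMixed n := by
  have h : ∀ i, (Φ.unitary i).1 * maxMixed n * star (Φ.unitary i).1 = maxMixed n := by
    intro i
    rw [maxMixed, Matrix.mul_smul, Matrix.smul_mul, mul_one,
      Matrix.mem_unitaryGroup_iff.1 (Φ.unitary i).2]
  simp only [MixedUnitary.map, h, ← Finset.sum_smul, Φ.weight_sum, one_smul]

theorem MixedUnitary.entropy_nonneg {n : ℕ} (Φ : MixedUnitary n) : 0 ≤ Φ.entropy := by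
  rw [MixedUnitary.entropy, ← Finset.sum_neg_distrib]
  refine Finset.sum_nonneg fun i _ => ?_
  have h1 : Φ.weight i ≤ 1 :=
    Φ.weight_sum ▸ Finset.single_le_sum (fun i _ => Φ.weight_nonneg i) (Finset.mem_univ i)
  have := mul_nonneg (Φ.weight_nonneg i)
    (neg_nonneg.2 (Real.logb_nonpos (b := 2) (by norm_num) (Φ.weight_nonneg i) h1))
  linarith

/-- The identity channel. -/
def MixedUnitary.identity (n : ℕ) : MixedUnitary n where
  r := 1
  weight _ := 1
  unitary _ := 1
  weight_nonneg _ := zero_le_one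
  weight_sum := by simp

theorem identity_map {n : ℕ} (ρ : Op (Fin n)) : (MixedUnitary.identity n).map ρ = ρ := by
  show ∑ i : Fin 1, (1 : ℝ) • ((1 : Matrix _ _ ℂ) * ρ * star (1 : Matrix _ _ ℂ)) = ρ
  simp

theorem identity_entropy (n : ℕ) : (MixedUnitary.identity n).entropy = 0 := by
  simp [MixedUnitary.entropy, MixedUnitary.identity]

theorem isEfficientFamily_identity {𝒢 : GateSet} (hC : cnot ∈ 𝒢.two) (m κ : ℕ → ℕ) :
    IsEfficientFamily 𝒢 m κ MixedUnitary.identity := by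
  refine ⟨QPT.keepFirst hC, fun n ρ => ?_⟩
  rw [identity_map]
  refine (outputState_keepFirst hC n (m n) (κ n) 0 ρ).trans ?_
  ext a b
  simp only [traceLast, Matrix.of_apply, Fintype.sum_unique]
  congr 1 <;>
  · funext i
    exact Fin.append_left _ _ i

theorem sum_norm_sq_unitary_mulVec {ι : Type} [Fintype ι] [DecidableEq ι]
    (U : Matrix.unitaryGroup ι ℂ) (x : ι → ℂ) :
    ∑ a, ‖(U.1.mulVec x) a‖ ^ 2 = ∑ a, ‖x a‖ ^ 2 := by
  have h : ∀ y : ι → ℂ, ((∑ a, ‖y a‖ ^ 2 : ℝ) : ℂ) = star y ⬝ᵥ y := by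
    intro y
    simp [dotProduct, Complex.conj_mul']
  apply Complex.ofReal_injective
  rw [h, h, Matrix.star_mulVec, Matrix.dotProduct_mulVec, Matrix.vecMul_vecMul,
    ← Matrix.star_eq_conjTranspose, Matrix.mem_unitaryGroup_iff'.1 U.2, Matrix.vecMul_one]

/-- Slicing ψ_k by the traced-out bits c writes ν₀ as a sum of 2^(κ+m) rank-one terms, one for each
pair (k, c) and scaled by s² = 2^(-κ); every U_i carries them to an ensemble of the same size. -/
theorem sum_weight_le_of_prdmState {m κ : ℕ → ℕ} {ψ : KeyedStates m κ}
    (hψ : ∀ n k, ∑ x, ‖ψ n k x‖ ^ 2 = 1) (n : ℕ) (Φ : MixedUnitary n) (S : Finset (Fin Φ.r)) :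
    ∑ i ∈ S, Φ.weight i ≤ (S.card * 2 ^ (κ n + m n) : ℕ) / 2 ^ n +
      traceNorm (Φ.map (prdmState ψ n) - maxMixed n) := by
  set s : ℝ := √((2 ^ κ n)⁻¹) with hs
  have hss : s * s = (2 ^ κ n)⁻¹ := Real.mul_self_sqrt (by positivity)
  have hss' : (s : ℂ) * s = (2 ^ κ n)⁻¹ := by
    rw [← Complex.ofReal_mul, hss]
    push_cast
    rfl
  set u : (Fin (κ n) → Bool) × (Fin (m n) → Bool) → (Fin n → Bool) → ℂ :=
    fun l a => ψ n l.1 (Fin.append a l.2) with hu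
  set χ : Fin Φ.r → (Fin (κ n) → Bool) × (Fin (m n) → Bool) → EuclideanSpace ℂ (Fin n → Bool) :=
    fun i l => (s : ℂ) • WithLp.toLp 2 ((Φ.unitary i).1.mulVec (u l)) with hχ
  have hcard : Fintype.card ((Fin (κ n) → Bool) × (Fin (m n) → Bool)) = 2 ^ (κ n + m n) := by
    simp [pow_add]
  rw [← hcard]
  refine sum_weight_le_traceNorm Φ.weight_nonneg (χ := χ) (fun i => ?_) (fun a b => ?_)
    (by positivity) S
  · have h1 : ∀ l, ‖χ i l‖ ^ 2 = (2 ^ κ n)⁻¹ * ∑ a, ‖u l a‖ ^ 2 := by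
      intro l
      rw [← sum_norm_sq_unitary_mulVec (Φ.unitary i) (u l), ← hss, hχ, norm_smul, mul_pow,
        EuclideanSpace.norm_sq_eq, Complex.norm_real, Real.norm_eq_abs, sq_abs, sq]
    have h2 : ∀ k, ∑ c, ∑ a, ‖u (k, c) a‖ ^ 2 = 1 := by
      intro k
      rw [← hψ n k, ← (Fin.appendEquiv n (m n)).sum_comp, Fintype.sum_prod_type, Finset.sum_comm]
      rfl
    simp only [h1, ← Finset.mul_sum, Fintype.sum_prod_type, h2]
    simp
  · have hν : ∀ x y, prdmState ψ n x y = ∑ l, (s : ℂ) * u l x * star ((s : ℂ) * u l y) := by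
      intro x y
      simp only [prdmState, keyAverage_apply, prdm, traceLast, pureState, Matrix.of_apply,
        Fintype.sum_prod_type, Finset.mul_sum, hu]
      refine Finset.sum_congr rfl fun k _ => Finset.sum_congr rfl fun c _ => ?_
      rw [← hss', star_mul', Complex.star_def, Complex.conj_ofReal]
      ring
    have hU : ∀ i, ((Φ.unitary i).1 * prdmState ψ n * star (Φ.unitary i).1) a b =
        ∑ l, χ i l a * star (χ i l b) := by
      intro i
      simp only [Matrix.mul_apply, hν, Matrix.star_apply, hχ, PiLp.smul_apply, Matrix.mulVec,
        dotProduct, smul_eq_mul, Finset.mul_sum, Finset.sum_mul, star_sum, star_mul']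
      calc _ = ∑ y, ∑ l, ∑ x, _ := Finset.sum_congr rfl fun y _ => Finset.sum_comm
        _ = ∑ l, ∑ y, ∑ x, _ := Finset.sum_comm
        _ = _ := Finset.sum_congr rfl fun l _ => Finset.sum_congr rfl fun y _ =>
            Finset.sum_congr rfl fun x _ => by ring
    rw [Matrix.sub_apply, MixedUnitary.map, Matrix.sum_apply]
    simp only [Matrix.smul_apply, hU, Complex.real_smul]
    simp [maxMixed]

/-! ## The three properties of an EFI pair -/

/-- The PRS is secure in terms of `n`, the EFI pair in terms of `κ`. For 0 < κ ≤ n the bound n^(-d)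
is the stronger one. -/
theorem Negligible.of_le {κ : ℕ → ℕ} {f : ℕ → ℝ} (hf : Negligible id f)
    (h0 : ∀ᶠ n in atTop, 0 < κ n) (h1 : ∀ᶠ n in atTop, κ n ≤ n) : Negligible κ f := by
  intro d
  filter_upwards [hf d, h0, h1] with n hn hn0 hn1
  refine hn.trans_le ?_
  have : (0 : ℝ) < κ n := by exact_mod_cast hn0
  have : (κ n : ℝ) ≤ n := by exact_mod_cast hn1
  simp only [id]
  gcongr

theorem IsPRS.negligible_prdmState {𝒢 : GateSet} (hC : cnot ∈ 𝒢.two) {m κ : ℕ → ℕ}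
    {ψ : KeyedStates m κ} (hψ : IsPRS 𝒢 m κ ψ) (A : QPT 𝒢) :
    Negligible id fun n => |acceptProb (A.circuit n (m n) (κ n)) (copies 1 (prdmState ψ n)) -
      acceptProb (A.circuit n (m n) (κ n)) (copies 1 (maxMixed n))| := by
  have h := hψ.pseudorandom (QPT.comp hC 0 (QPT.keepFirst hC) A) 1
  have hacc : ∀ n (ρ : Op (Fin (n + m n))),
      acceptProb ((QPT.comp hC 0 (QPT.keepFirst hC) A).circuit n (m n) (κ n)) (copies 1 ρ) =
        acceptProb (A.circuit n (m n) (κ n)) (copies 1 (traceLast ρ)) := by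
    intro n ρ
    rw [acceptProb_comp hC 0 _ _ _ _ _ (k := n) (by simp [initStore]), outputState_keepFirst]
  intro d
  filter_upwards [h d] with n hn
  -- The type of the input register depends on the number of copies, so the identity is stated for a
  -- variable `t` and then used at `Polynomial.eval n 1`.
  have ht : ∀ t, t = 1 →
      |keyAverage (fun k => acceptProb
          ((QPT.comp hC 0 (QPT.keepFirst hC) A).circuit n (m n) (κ n))
          (copies t (pureState (ψ n k)))) -
        ∫ φ, acceptProb ((QPT.comp hC 0 (QPT.keepFirst hC) A).circuit n (m n) (κ n))
          (copies t (pureState φ)) ∂haarState (n + m n)| =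
      |acceptProb (A.circuit n (m n) (κ n)) (copies 1 (prdmState ψ n)) -
        acceptProb (A.circuit n (m n) (κ n)) (copies 1 (maxMixed n))| := by
    rintro t rfl
    rw [integral_acceptProb_haarState, acceptProb_keyAverage, hacc, hacc, traceLast_maxMixed,
      traceLast_keyAverage]
    rfl
  rwa [ht _ Polynomial.eval_one] at hn

theorem exists_qpt_prdmState {𝒢 : GateSet} (hH : hadamard ∈ 𝒢.one) (hC : cnot ∈ 𝒢.two)
    {m κ : ℕ → ℕ} {ψ : KeyedStates m κ} (hψ : IsPRS 𝒢 m κ ψ) :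
    ∃ G : QPT 𝒢, ∀ n, outputState (G.circuit n (m n) (κ n)) n (1 : Op (Fin 0)) =
      prdmState ψ n := by
  obtain ⟨G, hG⟩ := hψ.efficient
  refine ⟨QPT.comp hC 2 (QPT.coins hH hC 2) G, fun n => ?_⟩
  have h2 : (initStore n (m n) (κ n) 2).length = κ n := by simp [initStore]
  rw [outputState_comp hC 2 _ _ _ _ _ h2, outputState_qptCoins hH hC 2 _ _ _ h2,
    outputState_traceLast _ n (m n), outputState_maxMixed, traceLast_keyAverage]
  simp only [hG]
  rfl

theorem exists_far_polynomial {m κ : ℕ → ℕ} {ψ : KeyedStates m κ}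
    (hψ : ∀ n k, ∑ x, ‖ψ n k x‖ ^ 2 = 1) {c : ℝ} (hc : 0 < c) (hκ : ∀ n, c * n < κ n + 1)
    (Φ : ∀ n, MixedUnitary n)
    (hH : ∀ᶠ n : ℕ in atTop, (Φ n).entropy ≤ (n : ℝ) - κ n - m n - 2) :
    ∃ p : Polynomial ℕ, ∀ᶠ n in atTop, 1 ≤ ((p.eval (κ n) : ℕ) : ℝ) *
      traceNorm ((Φ n).map (prdmState ψ n) - maxMixed n) := by
  -- The factor 4 inverts 1/4 ≤ N·T, and N ≤ n ≤ ⌈1/c⌉(κ + 1) by `hκ`.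
  refine ⟨Polynomial.C (4 * ⌈1 / c⌉₊) * (Polynomial.X + 1), ?_⟩
  filter_upwards [hH] with n hn
  set T := traceNorm ((Φ n).map (prdmState ψ n) - maxMixed n) with hT
  have hT0 : 0 ≤ T := traceNorm_nonneg _
  have hle : κ n + m n + 2 ≤ n := by
    have := (Φ n).entropy_nonneg.trans hn
    have : (κ n : ℝ) + m n + 2 ≤ n := by linarith
    exact_mod_cast this
  obtain ⟨N, hN⟩ := Nat.exists_eq_add_of_le (show κ n + m n ≤ n by omega)
  have hNr : (n : ℝ) = κ n + m n + N := by exact_mod_cast hN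
  have key : 1 / 4 ≤ N * T := by
    refine entropy_layer_bound (Φ n).weight_nonneg (Φ n).weight_sum (fun S => ?_)
      (hn.trans (by linarith))
    refine (sum_weight_le_of_prdmState hψ n (Φ n) S).trans (le_of_eq ?_)
    congr 1
    have h2 : (2 : ℝ) ^ n = 2 ^ (κ n + m n) * 2 ^ N := by rw [← pow_add, ← hN]
    rw [h2]
    push_cast
    rw [mul_comm (S.card : ℝ), mul_div_mul_left _ _ (by positivity)]
  have hn1 : (n : ℝ) ≤ ⌈1 / c⌉₊ * (κ n + 1) := by
    have h1 : (n : ℝ) ≤ 1 / c * (κ n + 1) := by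
      rw [one_div_mul_eq_div, le_div_iff₀ hc]
      linarith [hκ n]
    exact h1.trans (mul_le_mul_of_nonneg_right (Nat.le_ceil _) (by positivity))
  have hNn : (N : ℝ) ≤ ⌈1 / c⌉₊ * (κ n + 1) := by
    refine le_trans ?_ hn1
    rw [hNr]
    linarith [(Nat.cast_nonneg (κ n) : (0 : ℝ) ≤ _), (Nat.cast_nonneg (m n) : (0 : ℝ) ≤ _)]
  have := mul_le_mul_of_nonneg_right hNn hT0
  simp only [Polynomial.eval_mul, Polynomial.eval_C, Polynomial.eval_add, Polynomial.eval_X,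
    Polynomial.eval_one]
  push_cast
  linarith

/-- A mixed unitary channel of small entropy maps the mixed states of a pseudorandom family and the
maximally mixed state to an EFI pair. -/
theorem IsPRS.isEFI_map {𝒢 : GateSet} (hH : hadamard ∈ 𝒢.one) (hC : cnot ∈ 𝒢.two) {m κ : ℕ → ℕ}
    {ψ : KeyedStates m κ} (hψ : IsPRS 𝒢 m κ ψ) {c : ℝ} (hc : 0 < c)
    (hκ : ∀ n, c * n < κ n + 1) {Φ : ∀ n, MixedUnitary n} (hΦ : IsEfficientFamily 𝒢 m κ Φ)
    (hent : ∀ᶠ n : ℕ in atTop, (Φ n).entropy ≤ (n : ℝ) - κ n - m n - 2) :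
    IsEFI 𝒢 m κ (pair (fun n => (Φ n).map (prdmState ψ n)) fun n => (Φ n).map (maxMixed n)) := by
  have h0 : ∀ n m κ, (initStore n m κ 0).length = n := by simp [initStore]
  obtain ⟨F, hF⟩ := hΦ
  refine ⟨fun b => ?_, ?_, fun A => ?_⟩
  · cases b with
    | false =>
      obtain ⟨G, hG⟩ := exists_qpt_prdmState hH hC hψ
      refine ⟨QPT.comp hC 0 G F, fun n => ?_⟩
      rw [outputState_comp hC 0 _ _ _ _ _ (h0 _ _ _), hG, hF]
      rfl
    | true =>
      refine ⟨QPT.coins hH hC 0, fun n => ?_⟩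
      rw [outputState_qptCoins hH hC 0 _ _ _ (h0 _ _ _)]
      exact (map_maxMixed (Φ n)).symm
  · simpa [pair, map_maxMixed] using exists_far_polynomial hψ.normalized hc hκ Φ hent
  · refine Negligible.of_le ?_ ?_ ?_
    -- Running Φ and then `A` is itself an efficient distinguisher of ν₀ from I/2^n.
    · have h := hψ.negligible_prdmState hC (QPT.comp hC 0 F A)
      simp only [acceptProb_comp hC 0 F A _ _ _ (h0 _ _ _), hF] at h
      exact h
    · filter_upwards [eventually_ge_atTop ⌈1 / c⌉₊] with n hn
      have h1 : 1 / c ≤ n := (Nat.le_ceil _).trans (by exact_mod_cast hn)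
      have h2 : 1 ≤ c * n := by
        rw [div_le_iff₀ hc] at h1
        linarith
      have h3 : (0 : ℝ) < κ n := by linarith [hκ n]
      exact_mod_cast h3
    · filter_upwards [hent] with n hn
      have h1 := (Φ n).entropy_nonneg.trans hn
      have h2 : (κ n : ℝ) ≤ n := by linarith [(Nat.cast_nonneg (m n) : (0 : ℝ) ≤ m n)]
      exact_mod_cast h2

end

end QCrypto

/-! ### The arithmetic of the three parameter regimes. -/

theorem mainTheorem6 (𝒢 : GateSet) (hH : hadamard ∈ 𝒢.one) (hC : cnot ∈ 𝒢.two)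
    (c : ℝ) (hc0 : 0 < c) (hc1 : c < 1)
    (m : ℕ → ℕ) (hm : (fun n : ℕ => Real.log n) =o[atTop] fun n => (m n : ℝ)) :
    (∀ (κ : ℕ → ℕ) (ψ : KeyedStates m κ), (∀ n, κ n = ⌊c * (n + m n)⌋₊) → IsPRS 𝒢 m κ ψ →
      (∀ᶠ n : ℕ in atTop, (m n : ℝ) < (n : ℝ) / 2 * (1 - c) - 1 / 2) →
      IsEFI 𝒢 m κ (pair (prdmState ψ) maxMixed)) ∧
    (∀ (κ : ℕ → ℕ) (ψ : KeyedStates m κ), (∀ n, κ n = ⌊c * n⌋₊) → IsPRS 𝒢 m κ ψ →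
      ∀ Φ : ∀ n, MixedUnitary n, IsEfficientFamily 𝒢 m κ Φ →
      (∀ᶠ n : ℕ in atTop, (Φ n).entropy ≤ n * (1 - c) - m n - 2) →
      IsEFI 𝒢 m κ (pair (fun n => (Φ n).map (prdmState ψ n)) fun n => (Φ n).map (maxMixed n))) ∧
    (∀ (κ : ℕ → ℕ) (ψ : KeyedStates m κ), (∀ n, κ n = ⌊c * (n + m n)⌋₊) → IsPRS 𝒢 m κ ψ →
      ∀ Φ : ∀ n, MixedUnitary n, IsEfficientFamily 𝒢 m κ Φ →
      (∀ᶠ n : ℕ in atTop, (Φ n).entropy ≤ n * (1 - c) - (1 + c) * m n - 2) →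
      IsEFI 𝒢 m κ (pair (fun n => (Φ n).map (prdmState ψ n)) fun n => (Φ n).map (maxMixed n))) :=
  by
  have hm0 : ∀ n, (0 : ℝ) ≤ m n := fun n => Nat.cast_nonneg _
  have hupper : ∀ n, (⌊c * (n + m n)⌋₊ : ℝ) ≤ c * (n + m n) := fun n =>
    Nat.floor_le (by have := hm0 n; positivity)
  have hlower : ∀ n : ℕ, c * n < (⌊c * (n + m n)⌋₊ : ℝ) + 1 := fun n =>
    lt_of_le_of_lt (by have := mul_nonneg hc0.le (hm0 n); linarith) (Nat.lt_floor_add_one _)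
  refine ⟨fun κ ψ hκ hψ h => ?_, fun κ ψ hκ hψ Φ hΦ h => ?_, fun κ ψ hκ hψ Φ hΦ h => ?_⟩
  · have := hψ.isEFI_map hH hC hc0 (fun n => by rw [hκ]; exact hlower n)
      (isEfficientFamily_identity hC m κ) ?_
    · simpa only [identity_map] using this
    · filter_upwards [h] with n hn
      -- Since c < 1, κ + m + 1 ≤ cn + (1 + c)m + 1 ≤ cn + 2m + 1 < n. Integrality then turns the
      -- strict inequality into the slack of 2 that `IsPRS.isEFI_map` needs.
      have h1 : (κ n : ℝ) + m n + 1 < n := by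
        have h2 : (κ n : ℝ) ≤ c * (n + m n) := by rw [hκ]; exact hupper n
        have h3 := mul_nonneg (sub_nonneg.2 hc1.le) (hm0 n)
        linarith
      have h2 : κ n + m n + 2 ≤ n := by
        have : κ n + m n + 1 < n := by exact_mod_cast h1
        omega
      have h3 : (κ n : ℝ) + m n + 2 ≤ n := by exact_mod_cast h2
      rw [identity_entropy]
      linarith
  · refine hψ.isEFI_map hH hC hc0 (fun n => by rw [hκ]; exact Nat.lt_floor_add_one _) hΦ ?_
    filter_upwards [h] with n hn
    have : (κ n : ℝ) ≤ c * n := by rw [hκ]; exact Nat.floor_le (by positivity)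
    linarith
  · refine hψ.isEFI_map hH hC hc0 (fun n => by rw [hκ]; exact hlower n) hΦ ?_
    filter_upwards [h] with n hn
    have : (κ n : ℝ) ≤ c * (n + m n) := by rw [hκ]; exact hupper n
    linarith
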